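/- Let $\mathcal R$ be a ring with unit (not necessarily commutative), and let $\mathcal R[t]$ be the ring of polynomials over $\mathcal R$ in a central variable $t$. **Definitions.** For a ring $\mathcal S$, $\mathrm{El}_N(\mathcal S)\subseteq \mathrm{GL}_N(\mathcal S)$ is the subgroup generated by the basic elementary matrices (those equal to the identity except possibly in one off-diagonal entry). Square matrices $M$ ($n\times n$) and $M'$ ($m\times m$) over $\mathcal S$ are $\mathrm{El}(\mathcal S)$ *equivalent* if there are $N\ge \max(n,m)$ and $U,V\in \mathrm{El}_N(\mathcal S)$ with $U(M\oplus I_{N-n})V=M'\oplus I_{N-m}$. Square matrices $A,B$ over $\mathcal R$, possibly of different sizes, are *elementary strong shift equivalent* over $\mathcal R$ if there are rectangular matrices $U,V$ over $\mathcal R$ with $A=UV$ and $B=VU$; they are *strong shift equivalent* over $\mathcal R$ (SSE-$\mathcal R$) if they are connected by a finite chain of elementary strong shift equivalences. Let $A$ be an $n\times n$ matrix with entries in $t\mathcal R[t]$. Choose $N\ge n$ and $k$ such that all entries of $A$ have degree at most $k$, and write $A\oplus 0_{N-n}=\sum_{i=1}^k t^iA_i$ with $A_i$ an $N\times N$ matrix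 over $\mathcal R$. Let $A^{\Box}=A^{\Box(k,N)}$ be the $kN\times kN$ matrix over $\mathcal R$, in $N\times N$ blocks, with first block row $(A_1,A_2,\dots,A_k)$, with identity blocks immediately below the block diagonal, and with all other blocks zero. **Theorem.** There is a bijection from the set of $\mathrm{El}(\mathcal R[t])$ equivalence classes of square matrices of the form $I-A$, with $A$ over $t\mathcal R[t]$, to the set of SSE-$\mathcal R$ classes of square matrices over $\mathcal R$. It sends the class of $I-A$ to the SSE-$\mathcal R$ class of $A^{\Box(k,N)}$, for every admissible choice of $k$ and $N$. Its inverse sends the SSE-$\mathcal R$ class of a square matrix $A$ over $\mathcal R$ to the $\mathrm{El}(\mathcal R[t])$ equivalence class of $I-tA$. In particular, square matrices $A$ and $B$ over $\mathcal R$ are SSE-$\mathcal R$ if and only if $I-tA$ and $I-tB$ are $\mathrm{El}(\mathcal R[t])$ equivalent. -/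

import Mathlib

open Polynomial

namespace SSEK

universe u

/-- A finite square matrix over `S`, of arbitrary size. -/
abbrev SqMat (S : Type u) : Type u := Σ n : ℕ, Matrix (Fin n) (Fin n) S

section Elementary

variable {S : Type u} [Ring S]

/-- `El_N(S)`: the subgroup of `GL_N(S)` generated by the basic elementary matrices, i.e. those
equal to the identity except possibly in a single off-diagonal entry. -/
def El (S : Type u) [Ring S] (N : ℕ) : Subgroup (Matrix (Fin N) (Fin N) S)ˣ :=
  Subgroup.closure
    {u | ∃ i j : Fin N, i ≠ j ∧ ∃ c : S,
      (u : Matrix (Fin N) (Fin N) S) = 1 + Matrix.single i j c}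

/-- For `n ≤ N`, the `N × N` matrix `M ⊕ I_{N-n}`; this is the `N × N` upper left corner of the
`ℕ × ℕ` matrix `M_st1` with upper left corner `M` and equal to the identity elsewhere. -/
def st1 {n : ℕ} (N : ℕ) (M : Matrix (Fin n) (Fin n) S) : Matrix (Fin N) (Fin N) S :=
  Matrix.of fun i j =>
    if h : (i : ℕ) < n ∧ (j : ℕ) < n then M ⟨i, h.1⟩ ⟨j, h.2⟩ else if i = j then 1 else 0

/-- For `n ≤ N`, the `N × N` matrix `M ⊕ 0`. -/
def st0 {n : ℕ} (N : ℕ) (M : Matrix (Fin n) (Fin n) S) : Matrix (Fin N) (Fin N) S :=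
  Matrix.of fun i j =>
    if h : (i : ℕ) < n ∧ (j : ℕ) < n then M ⟨i, h.1⟩ ⟨j, h.2⟩ else 0

/-- `El(S)` equivalence of finite square matrices, not necessarily of the same size:
`U M_st1 V = M'_st1` with `U, V ∈ El(S)`. As `El(S)` is the direct limit of the groups `El_N(S)`
along `E ↦ E ⊕ 1`, this is an equation at some finite stage `N`. -/
def ElEquiv {n m : ℕ} (M : Matrix (Fin n) (Fin n) S) (M' : Matrix (Fin m) (Fin m) S) : Prop :=
  ∃ N : ℕ, n ≤ N ∧ m ≤ N ∧ ∃ U ∈ El S N, ∃ V ∈ El S N,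
    (U : Matrix (Fin N) (Fin N) S) * st1 N M * (V : Matrix (Fin N) (Fin N) S) = st1 N M'

theorem st1_st1 {n N N' : ℕ} (h : n ≤ N) (M : Matrix (Fin n) (Fin n) S) :
    st1 N' (st1 N M) = st1 N' M := by
  ext i j
  simp only [st1, Matrix.of_apply, Fin.ext_iff]
  by_cases h1 : (i : ℕ) < n ∧ (j : ℕ) < n
  · have h2 : (i : ℕ) < N ∧ (j : ℕ) < N := ⟨by omega, by omega⟩
    simp [h1, h2]
  · by_cases h2 : (i : ℕ) < N ∧ (j : ℕ) < N <;> simp [h1, h2]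

theorem st1_one {N N' : ℕ} : st1 N' (1 : Matrix (Fin N) (Fin N) S) = 1 := by
  ext i j
  simp only [st1, Matrix.of_apply, Matrix.one_apply, Fin.ext_iff]
  split_ifs <;> rfl

theorem st1_mul {N N' : ℕ} (h : N ≤ N') (A B : Matrix (Fin N) (Fin N) S) :
    st1 N' (A * B) = st1 N' A * st1 N' B := by
  obtain ⟨d, rfl⟩ := Nat.exists_eq_add_of_le h
  ext i j
  simp only [Matrix.mul_apply, Fin.sum_univ_add]
  refine Fin.addCases (fun i => ?_) (fun i => ?_) i <;>
    refine Fin.addCases (fun j => ?_) (fun j => ?_) j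
  all_goals
    have h1 (a : Fin N) (b : Fin d) : ((a : ℕ) = N + b) = False := by
      have := a.2
      exact eq_false (by omega)
    have h2 (a : Fin N) (b : Fin d) : (N + (b : ℕ) = a) = False := by
      have := a.2
      exact eq_false (by omega)
    simp [st1, Matrix.mul_apply, Fin.ext_iff, h1, h2]
  simp [← Fin.ext_iff]

/-- The homomorphism `E ↦ E ⊕ I` from `N × N` to `N' × N'` matrices. -/
def st1Hom {N N' : ℕ} (h : N ≤ N') : Matrix (Fin N) (Fin N) S →* Matrix (Fin N') (Fin N') S where
  toFun := st1 N'
  map_one' := st1_one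
  map_mul' := st1_mul h

theorem st1Hom_mem_El {N N' : ℕ} (h : N ≤ N') {U : (Matrix (Fin N) (Fin N) S)ˣ}
    (hU : U ∈ El S N) : Units.map (st1Hom h) U ∈ El S N' := by
  suffices El S N ≤ (El S N').comap (Units.map (st1Hom h)) from this hU
  refine (Subgroup.closure_le _).2 ?_
  rintro u ⟨i, j, hij, c, hu⟩
  refine Subgroup.subset_closure ⟨Fin.castLE h i, Fin.castLE h j, ?_, c, ?_⟩
  · simpa [Fin.ext_iff] using hij
  · change st1 N' (u : Matrix (Fin N) (Fin N) S) = _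
    rw [hu]
    ext a b
    simp only [st1, Matrix.of_apply, Matrix.add_apply, Matrix.one_apply, Matrix.single_apply,
      Fin.ext_iff, Fin.val_castLE]
    by_cases h1 : (a : ℕ) < N ∧ (b : ℕ) < N
    · simp [h1]
    · have h2 : ¬ ((i : ℕ) = a ∧ (j : ℕ) = b) := by
        have := i.2
        have := j.2
        omega
      simp [h1, h2]

theorem ElEquiv.refl {n : ℕ} (M : Matrix (Fin n) (Fin n) S) : ElEquiv M M :=
  ⟨n, le_rfl, le_rfl, 1, one_mem _, 1, one_mem _, by simp⟩

theorem ElEquiv.symm {n m : ℕ} {M : Matrix (Fin n) (Fin n) S} {M' : Matrix (Fin m) (Fin m) S}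
    (h : ElEquiv M M') : ElEquiv M' M := by
  obtain ⟨N, hn, hm, U, hU, V, hV, e⟩ := h
  refine ⟨N, hm, hn, U⁻¹, inv_mem hU, V⁻¹, inv_mem hV, ?_⟩
  rw [← e]
  simp [mul_assoc]

theorem ElEquiv.trans {n m l : ℕ} {M : Matrix (Fin n) (Fin n) S} {M' : Matrix (Fin m) (Fin m) S}
    {M'' : Matrix (Fin l) (Fin l) S} (h : ElEquiv M M') (h' : ElEquiv M' M'') :
    ElEquiv M M'' := by
  obtain ⟨N, hn, hm, U, hU, V, hV, e⟩ := h
  obtain ⟨P, hm', hl, U', hU', V', hV', e'⟩ := h'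
  have h1 : N ≤ max N P := le_max_left _ _
  have h2 : P ≤ max N P := le_max_right _ _
  refine ⟨max N P, hn.trans h1, hl.trans h2,
    Units.map (st1Hom h2) U' * Units.map (st1Hom h1) U,
    mul_mem (st1Hom_mem_El h2 hU') (st1Hom_mem_El h1 hU),
    Units.map (st1Hom h1) V * Units.map (st1Hom h2) V',
    mul_mem (st1Hom_mem_El h1 hV) (st1Hom_mem_El h2 hV'), ?_⟩
  have e1 := congrArg (st1 (max N P)) e
  have e2 := congrArg (st1 (max N P)) e'
  rw [st1_mul h1, st1_mul h1, st1_st1 hn, st1_st1 hm] at e1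
  rw [st1_mul h2, st1_mul h2, st1_st1 hm', st1_st1 hl] at e2
  rw [← e2, ← e1]
  simp [st1Hom, mul_assoc]

end Elementary

section StrongShift

variable {R : Type u} [Ring R]

/-- Elementary strong shift equivalence over `R`: `A = UV` and `B = VU` for some (rectangular)
matrices `U, V` over `R`. -/
def ESSE (A B : SqMat R) : Prop :=
  ∃ (U : Matrix (Fin A.1) (Fin B.1) R) (V : Matrix (Fin B.1) (Fin A.1) R),
    A.2 = U * V ∧ B.2 = V * U

/-- Strong shift equivalence over `R`: a finite chain of elementary strong shift equivalences. -/
def SSE : SqMat R → SqMat R → Prop := Relation.TransGen ESSE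

theorem ESSE.refl (A : SqMat R) : ESSE A A := ⟨A.2, 1, by simp, by simp⟩

theorem ESSE.symm {A B : SqMat R} (h : ESSE A B) : ESSE B A := by
  obtain ⟨U, V, h1, h2⟩ := h
  exact ⟨V, U, h2, h1⟩

theorem SSE.symm {A B : SqMat R} (h : SSE A B) : SSE B A := by
  induction h with
  | single h => exact .single h.symm
  | tail _ h ih => exact .head h.symm ih

/-- Strong shift equivalence as an equivalence relation. -/
def sseSetoid (R : Type u) [Ring R] : Setoid (SqMat R) where
  r := SSE
  iseqv := ⟨fun A => .single (ESSE.refl A), SSE.symm, Relation.TransGen.trans⟩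

/-- The set of SSE-`R` classes of square matrices over `R`. -/
abbrev SSEClasses (R : Type u) [Ring R] : Type u := Quotient (sseSetoid R)

/-- The SSE-`R` class of `A`. -/
def sseClass {n : ℕ} (A : Matrix (Fin n) (Fin n) R) : SSEClasses R :=
  Quotient.mk (sseSetoid R) ⟨n, A⟩

end StrongShift

section Polynomials

variable {R : Type u} [Ring R]

/-- The matrix `A` over `R[t]` has all its entries in `tR[t]`. -/
def OverT {n : ℕ} (A : Matrix (Fin n) (Fin n) R[X]) : Prop := ∀ i j, X ∣ A i j

/-- The set of square matrices over `R[t]` of the form `I - A` with `A` over `tR[t]`. -/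
def OneSubMat (R : Type u) [Ring R] : Type u :=
  {M : SqMat R[X] // ∃ A : Matrix (Fin M.1) (Fin M.1) R[X], OverT A ∧ M.2 = 1 - A}

/-- `El(R[t])` equivalence of matrices of the form `I - A` with `A` over `tR[t]`. -/
def elSetoid (R : Type u) [Ring R] : Setoid (OneSubMat R) where
  r M M' := ElEquiv M.1.2 M'.1.2
  iseqv := ⟨fun M => ElEquiv.refl M.1.2, ElEquiv.symm, ElEquiv.trans⟩

/-- The set of `El(R[t])` equivalence classes of square matrices `I - A`, `A` over `tR[t]`. -/
abbrev ElClasses (R : Type u) [Ring R] : Type u := Quotient (elSetoid R)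

/-- The `El(R[t])` equivalence class of `I - A`, for `A` over `tR[t]`. -/
noncomputable def elClass {n : ℕ} (A : Matrix (Fin n) (Fin n) R[X]) (hA : OverT A) : ElClasses R :=
  Quotient.mk (elSetoid R) ⟨⟨n, 1 - A⟩, A, hA, rfl⟩

/-- The matrix `tA` over `tR[t]`, for `A` over `R`. -/
noncomputable def tMul {n : ℕ} (A : Matrix (Fin n) (Fin n) R) : Matrix (Fin n) (Fin n) R[X] :=
  A.map fun a => X * C a

theorem overT_tMul {n : ℕ} (A : Matrix (Fin n) (Fin n) R) : OverT (tMul A) :=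
  fun i j => ⟨C (A i j), rfl⟩

/-- For an `n × n` matrix `A = ∑_{i=1}^k t^i A_i` over `tR[t]`, the `kn × kn` block matrix with
`n × n` blocks which has first block row `A_1, …, A_k`, identity blocks directly below the block
diagonal, and zero blocks elsewhere. The entry at position `p` of block number `a` has index
`a * n + p` (all counted from `0`). -/
def box (k : ℕ) {n : ℕ} (A : Matrix (Fin n) (Fin n) R[X]) :
    Matrix (Fin (k * n)) (Fin (k * n)) R :=
  Matrix.reindex finProdFinEquiv finProdFinEquiv <|
    Matrix.of fun p q : Fin k × Fin n =>
      if (p.1 : ℕ) = 0 then (A p.2 q.2).coeff ((q.1 : ℕ) + 1)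
      else if (p.1 : ℕ) = (q.1 : ℕ) + 1 ∧ p.2 = q.2 then 1 else 0

end Polynomials

end SSEK

/-! The forward map is well defined because of a factorization property of companion matrices. If
`(1 - P)(1 - Q) = 1 - A` over `R[t]` with no constant terms in `P` and `Q`, the block companion
matrix of `A` is conjugate to a block triangular matrix with the companion matrices of `P` and `Q`
on its diagonal (`companion_semiconj_joinedCompanion`). When one factor is strictly triangular, its
diagonal block can be deleted by removing zero rows (or columns) one at a time, and each removal is
an elementary strong shift equivalence. So multiplying `1 - A` by a unipotent triangular matrix that
is trivial at `t = 0` does not change the SSE class.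

A general elementary matrix is the product of such a matrix with its value at `t = 0`, and a
constant invertible matrix acts by conjugation on companion matrices. In an equation `U(1 - A)V = 1
- B` the values of `U` and `V` at `t = 0` are mutually inverse, so the constant parts combine into
one conjugation (`polyClass_eq_of_El_mul_El`).

The backward map is well defined because `1 - UV` and `1 - VU` are stably elementary equivalent
(`elEquiv_one_sub_mul_comm`), applied to `tU` and `V`. The two maps are mutually inverse: the
companion matrix of `tA` with one block is `A` itself (`polyClass_tMul`), and a Horner scheme
reduces `1 - A` to the linear matrix `1 - tA^□` (`stableClass_timesT_companion`). -/

namespace SSEK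

universe u v w

/-! ### Triangular unipotent matrices as products of elementary matrices -/

section ElementaryMonoid

variable {S : Type u} [Ring S]

/-- The multiplicative monoid generated by the basic elementary matrices, over an arbitrary finite
index type. -/
def elemMonoid (ι : Type v) [Fintype ι] [DecidableEq ι] (S : Type u) [Ring S] :
    Submonoid (Matrix ι ι S) :=
  Submonoid.closure {M | ∃ i j : ι, i ≠ j ∧ ∃ c : S, M = 1 + Matrix.single i j c}

variable {ι : Type v} [Fintype ι] [DecidableEq ι]

theorem one_add_single_mul_one_sub_single {i j : ι} (h : i ≠ j) (c : S) :
    (1 + Matrix.single i j c) * (1 + Matrix.single i j (-c)) = 1 := by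
  simp only [add_mul, one_mul, mul_add, mul_one, Matrix.single_mul_single_of_ne _ _ _ _ h.symm,
    add_zero, add_assoc, ← Matrix.single_add]
  simp

theorem one_add_single_mem_elemMonoid {i j : ι} (h : i ≠ j) (c : S) :
    1 + Matrix.single i j c ∈ elemMonoid ι S :=
  Submonoid.subset_closure ⟨i, j, h, c, rfl⟩

theorem isUnit_of_mem_elemMonoid {M : Matrix ι ι S} (h : M ∈ elemMonoid ι S) : IsUnit M := by
  induction h using Submonoid.closure_induction with
  | mem x hx =>
    obtain ⟨i, j, hij, c, rfl⟩ := hx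
    refine ⟨⟨_, _, one_add_single_mul_one_sub_single hij c, ?_⟩, rfl⟩
    simpa using one_add_single_mul_one_sub_single hij (-c)
  | one => exact isUnit_one
  | mul x y _ _ hx hy => exact hx.mul hy

theorem exists_mem_El_of_mem_elemMonoid {n : ℕ} {M : Matrix (Fin n) (Fin n) S}
    (h : M ∈ elemMonoid (Fin n) S) :
    ∃ U ∈ El S n, (U : Matrix (Fin n) (Fin n) S) = M := by
  induction h using Submonoid.closure_induction with
  | mem x hx =>
    obtain ⟨U, rfl⟩ := isUnit_of_mem_elemMonoid (Submonoid.subset_closure hx)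
    exact ⟨U, Subgroup.subset_closure hx, rfl⟩
  | one => exact ⟨1, one_mem _, rfl⟩
  | mul x y _ _ hx hy =>
    obtain ⟨U, hU, rfl⟩ := hx
    obtain ⟨V, hV, rfl⟩ := hy
    exact ⟨U * V, mul_mem hU hV, rfl⟩

theorem submatrix_mem_elemMonoid {κ : Type w} [Fintype κ] [DecidableEq κ] (e : κ ≃ ι)
    {M : Matrix ι ι S} (h : M ∈ elemMonoid ι S) : M.submatrix e e ∈ elemMonoid κ S := by
  induction h using Submonoid.closure_induction with
  | mem x hx =>
    obtain ⟨i, j, hij, c, rfl⟩ := hx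
    refine Submonoid.subset_closure ⟨e.symm i, e.symm j, by simpa using hij, c, ?_⟩
    ext a b
    simp [Matrix.one_apply, Matrix.single_apply, Equiv.symm_apply_eq]
  | one => simp
  | mul x y _ _ hx hy =>
    rw [← Matrix.submatrix_mul_equiv _ _ _ e]
    exact mul_mem hx hy

/-- No column index in `T` is a row index in `T`, so products of two of the summands vanish and the
sum expands as a product of elementary factors. -/
theorem one_add_sum_single_mem_elemMonoid (p : ι → Prop) (X : ι → ι → S) (T : Finset (ι × ι))
    (hT : ∀ a ∈ T, p a.1 ∧ ¬ p a.2) :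
    1 + ∑ a ∈ T, Matrix.single a.1 a.2 (X a.1 a.2) ∈ elemMonoid ι S := by
  classical
  induction T using Finset.induction_on with
  | empty => simp
  | insert a T ha ih =>
    have h1 := hT a (Finset.mem_insert_self _ _)
    have h2 : ∀ b ∈ T, p b.1 ∧ ¬ p b.2 := fun b hb => hT b (Finset.mem_insert_of_mem hb)
    have hne : a.1 ≠ a.2 := fun h => h1.2 (h ▸ h1.1)
    have h0 : Matrix.single a.1 a.2 (X a.1 a.2) *
        ∑ a ∈ T, Matrix.single a.1 a.2 (X a.1 a.2) = 0 := by
      rw [Finset.mul_sum]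
      refine Finset.sum_eq_zero fun b hb => Matrix.single_mul_single_of_ne _ _ _ _ ?_ _
      exact fun h => h1.2 (h ▸ (h2 b hb).1)
    have := mul_mem (one_add_single_mem_elemMonoid hne (X a.1 a.2)) (ih h2)
    rw [Finset.sum_insert ha]
    simpa [add_mul, mul_add, h0, add_assoc, add_comm, add_left_comm] using this

/-- If the support of `X` lies in `p × pᶜ`, then `1 + X` is a product of elementary matrices. -/
theorem one_add_mem_elemMonoid_of_support (p : ι → Prop) (X : Matrix ι ι S)
    (hX : ∀ i j, X i j ≠ 0 → p i ∧ ¬ p j) : 1 + X ∈ elemMonoid ι S := by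
  classical
  have := one_add_sum_single_mem_elemMonoid p X
    (Finset.univ.filter fun a : ι × ι => X a.1 a.2 ≠ 0) (fun a ha => hX _ _ (by simpa using ha))
  convert this using 2
  rw [Finset.sum_filter_of_ne, Fintype.sum_prod_type]
  · exact Matrix.matrix_eq_sum_single X
  · intro a _ h h0
    exact h (by rw [h0, Matrix.single_zero])

/-- If `X` is strictly triangular for some ordering of the indices, then `1 + X` is a product of
elementary matrices. -/
theorem one_add_mem_elemMonoid_of_height (h : ι → ℕ) (X : Matrix ι ι S)
    (hX : ∀ i j, X i j ≠ 0 → h j < h i) : 1 + X ∈ elemMonoid ι S := by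
  -- Rows are added one height at a time. A nonzero `X i l` with `h i < K` has `h l < K`, so the
  -- part already built times the layer of height `K` is zero and the product adds only that layer.
  have key (K : ℕ) :
      1 + (Matrix.of fun i j => if h i < K then X i j else 0) ∈ elemMonoid ι S := by
    induction K with
    | zero =>
      convert one_mem (elemMonoid ι S)
      ext i j
      simp
    | succ K ih =>
      have htop : 1 + (Matrix.of fun i j => if h i = K then X i j else 0) ∈ elemMonoid ι S := by
        refine one_add_mem_elemMonoid_of_support (fun i => h i = K) _ fun i j hij => ?_
        simp only [Matrix.of_apply, ne_eq, ite_eq_right_iff, Classical.not_imp] at hij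
        have := hX i j hij.2
        exact ⟨hij.1, by omega⟩
      convert mul_mem ih htop using 1
      have h0 : (Matrix.of fun i j => if h i < K then X i j else 0) *
          (Matrix.of fun i j => if h i = K then X i j else 0) = 0 := by
        ext i j
        rw [Matrix.mul_apply]
        refine Finset.sum_eq_zero fun l _ => ?_
        simp only [Matrix.of_apply]
        by_cases h1 : X i l = 0
        · simp [h1]
        · have := hX i l h1
          by_cases h2 : h i < K
          · rw [if_neg (by omega : ¬ h l = K), mul_zero]
          · rw [if_neg h2, zero_mul]
      rw [add_mul, one_mul, mul_add, mul_one, h0, add_zero, add_assoc]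
      congr 1
      ext i j
      simp only [Matrix.of_apply, Matrix.add_apply]
      rcases lt_trichotomy (h i) K with h1 | h1 | h1
      · simp [h1, h1.ne, h1.trans (Nat.lt_succ_self K)]
      · simp [h1]
      · simp [h1.ne', h1.not_gt, show ¬ h i < K + 1 by omega]
  convert key (Finset.univ.sup h + 1) using 2
  ext i j
  have : h i < Finset.univ.sup h + 1 :=
    Nat.lt_succ_of_le (Finset.le_sup (f := h) (Finset.mem_univ i))
  simp only [Matrix.of_apply, if_pos this]

end ElementaryMonoid

/-! ### SSE classes over arbitrary index types, and deletion of nilpotent parts -/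

section ShiftClass

variable {R : Type u} [Ring R]

/-- The SSE class of a square matrix indexed by an arbitrary finite type. -/
noncomputable def shiftClass {ι : Type v} [Fintype ι] (A : Matrix ι ι R) :
    SSEClasses R :=
  sseClass (A.submatrix (Fintype.equivFin ι).symm (Fintype.equivFin ι).symm)

theorem shiftClass_mul_comm {ι : Type v} {κ : Type w} [Fintype ι] [Fintype κ]
    (U : Matrix ι κ R) (V : Matrix κ ι R) : shiftClass (U * V) = shiftClass (V * U) := by
  refine Quotient.sound (Relation.TransGen.single ?_)
  refine ⟨U.submatrix (Fintype.equivFin ι).symm (Fintype.equivFin κ).symm,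
    V.submatrix (Fintype.equivFin κ).symm (Fintype.equivFin ι).symm, ?_, ?_⟩ <;>
  exact (Matrix.submatrix_mul_equiv _ _ _ _ _).symm

theorem sseClass_mul_comm {n m : ℕ} (U : Matrix (Fin n) (Fin m) R) (V : Matrix (Fin m) (Fin n) R) :
    sseClass (U * V) = sseClass (V * U) :=
  Quotient.sound (Relation.TransGen.single ⟨U, V, rfl, rfl⟩)

/-- The choice of enumeration is immaterial: two enumerations differ by one elementary strong shift
equivalence in which one factor is a permutation matrix. -/
theorem shiftClass_eq_sseClass {n : ℕ} {ι : Type v} [Fintype ι] (e : Fin n ≃ ι)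
    (A : Matrix ι ι R) : shiftClass A = sseClass (A.submatrix e e) := by
  classical
  set f := (Fintype.equivFin ι).symm
  have h1 : A.submatrix f f = A.submatrix f e * (1 : Matrix ι ι R).submatrix e f := by
    rw [Matrix.submatrix_mul_equiv, mul_one]
  have h2 : A.submatrix e e = (1 : Matrix ι ι R).submatrix e f * A.submatrix f e := by
    rw [Matrix.submatrix_mul_equiv, one_mul]
  rw [shiftClass, h1, h2, sseClass_mul_comm]

/-- Rows of zeros may be deleted together with the corresponding columns. -/
theorem shiftClass_submatrix_of_rows {ι : Type v} {κ : Type w} [Fintype ι] [Fintype κ]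
    (M : Matrix ι ι R) (e : κ → ι) (he : Function.Injective e)
    (hM : ∀ x, x ∉ Set.range e → ∀ y, M x y = 0) :
    shiftClass M = shiftClass (M.submatrix e e) := by
  classical
  have h1 : M = (1 : Matrix ι ι R).submatrix id e * M.submatrix e id := by
    ext x y
    rw [Matrix.mul_apply]
    by_cases hx : x ∈ Set.range e
    · obtain ⟨a, rfl⟩ := hx
      rw [Finset.sum_eq_single a]
      · change _ = (1 : Matrix ι ι R) (e a) (e a) * M (e a) y
        rw [Matrix.one_apply_eq, one_mul]
      · intro b _ hb
        simp [he.ne hb.symm]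
      · simp
    · rw [hM x hx, Finset.sum_eq_zero]
      intro b _
      have : x ≠ e b := fun h => hx ⟨b, h.symm⟩
      simp [this]
  conv_lhs => rw [h1]
  rw [shiftClass_mul_comm]
  congr 1
  ext a b
  simp [Matrix.mul_apply, Matrix.one_apply]

/-- Columns of zeros may be deleted together with the corresponding rows. -/
theorem shiftClass_submatrix_of_cols {ι : Type v} {κ : Type w} [Fintype ι] [Fintype κ]
    (M : Matrix ι ι R) (e : κ → ι) (he : Function.Injective e)
    (hM : ∀ y, y ∉ Set.range e → ∀ x, M x y = 0) :
    shiftClass M = shiftClass (M.submatrix e e) := by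
  classical
  have h1 : M = M.submatrix id e * (1 : Matrix ι ι R).submatrix e id := by
    ext x y
    rw [Matrix.mul_apply]
    by_cases hx : y ∈ Set.range e
    · obtain ⟨a, rfl⟩ := hx
      rw [Finset.sum_eq_single a]
      · change _ = M x (e a) * (1 : Matrix ι ι R) (e a) (e a)
        rw [Matrix.one_apply_eq, mul_one]
      · intro b _ hb
        simp [he.ne hb]
      · simp
    · rw [hM y hx, Finset.sum_eq_zero]
      intro b _
      have : e b ≠ y := fun h => hx ⟨b, h⟩
      simp [this]
  conv_lhs => rw [h1]
  rw [shiftClass_mul_comm]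
  congr 1
  ext a b
  simp [Matrix.mul_apply, Matrix.one_apply]

/-- Viewing nonzero entries as edges, edges leaving the complement of the range stay there and
descend in height. An index of least height in the complement therefore has a zero row; it is
deleted and the argument is repeated. -/
theorem shiftClass_submatrix_of_height_rows {ι : Type v} {κ : Type w} [Fintype ι] [Fintype κ]
    (M : Matrix ι ι R) (e : κ → ι) (he : Function.Injective e) (h : ι → ℕ)
    (hM : ∀ x, x ∉ Set.range e → ∀ y, M x y ≠ 0 → y ∉ Set.range e ∧ h y < h x) :
    shiftClass M = shiftClass (M.submatrix e e) := by
  classical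
  induction hn : Fintype.card ι generalizing ι with
  | zero =>
    have := Fintype.card_eq_zero_iff.1 hn
    exact shiftClass_submatrix_of_rows M e he fun x => isEmptyElim x
  | succ n ih =>
    by_cases hs : ∃ x, x ∉ Set.range e
    · obtain ⟨x, hx, hmin⟩ := (measure h).wf.has_min {x | x ∉ Set.range e} hs
      have hx0 (y) : M x y = 0 := by
        by_contra h0
        have := hM x hx y h0
        exact hmin y this.1 this.2
      rw [shiftClass_submatrix_of_rows M (Subtype.val : {y // y ≠ x} → ι) Subtype.val_injective]
      · have hne (a : κ) : e a ≠ x := fun h => hx ⟨a, h⟩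
        rw [ih _ (fun a => ⟨e a, hne a⟩) (fun a b hab => he (congrArg Subtype.val hab))
          (fun y => h y)]
        · rfl
        · intro y hy z hz
          have := hM y (fun ⟨a, ha⟩ => hy ⟨a, Subtype.ext ha⟩) z hz
          exact ⟨fun ⟨a, ha⟩ => this.1 ⟨a, congrArg Subtype.val ha⟩, this.2⟩
        · simp [Fintype.card_subtype_compl, hn]
      · intro y hy z
        have : y = x := by simpa using hy
        rw [this, hx0]
    · push Not at hs
      exact shiftClass_submatrix_of_rows M e he fun x hx => absurd (hs x) hx

theorem shiftClass_submatrix_of_height_cols {ι : Type v} {κ : Type w} [Fintype ι] [Fintype κ]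
    (M : Matrix ι ι R) (e : κ → ι) (he : Function.Injective e) (h : ι → ℕ)
    (hM : ∀ y, y ∉ Set.range e → ∀ x, M x y ≠ 0 → x ∉ Set.range e ∧ h x < h y) :
    shiftClass M = shiftClass (M.submatrix e e) := by
  classical
  induction hn : Fintype.card ι generalizing ι with
  | zero =>
    have := Fintype.card_eq_zero_iff.1 hn
    exact shiftClass_submatrix_of_cols M e he fun x => isEmptyElim x
  | succ n ih =>
    by_cases hs : ∃ x, x ∉ Set.range e
    · obtain ⟨x, hx, hmin⟩ := (measure h).wf.has_min {x | x ∉ Set.range e} hs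
      have hx0 (y) : M y x = 0 := by
        by_contra h0
        have := hM x hx y h0
        exact hmin y this.1 this.2
      rw [shiftClass_submatrix_of_cols M (Subtype.val : {y // y ≠ x} → ι) Subtype.val_injective]
      · have hne (a : κ) : e a ≠ x := fun h => hx ⟨a, h⟩
        rw [ih _ (fun a => ⟨e a, hne a⟩) (fun a b hab => he (congrArg Subtype.val hab))
          (fun y => h y)]
        · rfl
        · intro y hy z hz
          have := hM y (fun ⟨a, ha⟩ => hy ⟨a, Subtype.ext ha⟩) z hz
          exact ⟨fun ⟨a, ha⟩ => this.1 ⟨a, congrArg Subtype.val ha⟩, this.2⟩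
        · simp [Fintype.card_subtype_compl, hn]
      · intro y hy z
        have : y = x := by simpa using hy
        rw [this, hx0]
    · push Not at hs
      exact shiftClass_submatrix_of_cols M e he fun x hx => absurd (hs x) hx

end ShiftClass

/-! ### The companion matrix of a product -/

section Companion

variable {S : Type u} [Ring S]

/-- The companion matrix of the sequence `s 1, …, s k`. -/
def companion (k : ℕ) (s : ℕ → S) : Matrix (Fin k) (Fin k) S :=
  Matrix.of fun a b =>
    if (a : ℕ) = 0 then s ((b : ℕ) + 1) else if (a : ℕ) = (b : ℕ) + 1 then 1 else 0

/-- The companion matrices of `P` and `Q` on the diagonal, with a single further entry `1` joining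
the last state of `P` to the first one of `Q`. -/
def joinedCompanion (p q : ℕ) (P Q : ℕ → S) : Matrix (Fin (p + q)) (Fin (p + q)) S :=
  Matrix.of fun a b =>
    (if (a : ℕ) = 0 ∧ (b : ℕ) < p then P ((b : ℕ) + 1) else 0) +
    (if (a : ℕ) = (b : ℕ) + 1 then 1 else 0) +
    (if (a : ℕ) = p ∧ p ≤ (b : ℕ) then Q ((b : ℕ) - p + 1) else 0)

/-- The strictly triangular part of the change of coordinates used in
`companion_semiconj_joinedCompanion`. -/
def joinTransition (p q : ℕ) (Q : ℕ → S) : Matrix (Fin (p + q)) (Fin (p + q)) S :=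
  Matrix.of fun a b => if (a : ℕ) < p ∧ (a : ℕ) < (b : ℕ) then -Q ((b : ℕ) - (a : ℕ)) else 0

variable {p q : ℕ} {P Q : ℕ → S}

/-- Column `0` of `joinTransition` is zero, so the row containing `s` never contributes; the
subdiagonal identity just shifts columns by one. -/
theorem joinTransition_mul_companion (hQ : ∀ n, q < n → Q n = 0) (s : ℕ → S) (a b : Fin (p + q)) :
    (joinTransition p q Q * companion (p + q) s) a b =
      if (a : ℕ) < p ∧ (a : ℕ) ≤ (b : ℕ) then -Q ((b : ℕ) + 1 - (a : ℕ)) else 0 := by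
  rw [Matrix.mul_apply]
  have key (c : Fin (p + q)) : joinTransition p q Q a c * companion (p + q) s c b =
      if (c : ℕ) = (b : ℕ) + 1 then joinTransition p q Q a c else 0 := by
    simp only [joinTransition, companion, Matrix.of_apply]
    by_cases h : (a : ℕ) < p ∧ (a : ℕ) < (c : ℕ)
    · have : (c : ℕ) ≠ 0 := by omega
      simp [this]
    · simp only [if_neg h, zero_mul, ite_self]
  simp only [key]
  by_cases hb : (b : ℕ) + 1 < p + q
  · rw [Finset.sum_eq_single ⟨(b : ℕ) + 1, hb⟩]
    · simp only [joinTransition, Matrix.of_apply, if_true, Nat.lt_succ_iff]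
    · intro c _ hc
      exact if_neg fun h => hc (Fin.ext h)
    · simp
  · rw [Finset.sum_eq_zero]
    -- In the last column the shifted index leaves the matrix. The stated value is still right:
    -- there `b + 1 = p + q` and `a < p`, so the argument of `Q` exceeds `q`.
    · split_ifs with h
      · have := b.2
        rw [hQ _ (by omega), neg_zero]
      · rfl
    · intro c _
      have := c.2
      rw [if_neg (by omega)]

theorem joinedCompanion_mul_joinTransition (hP : ∀ n, p < n → P n = 0) (a b : Fin (p + q)) :
    (joinedCompanion p q P Q * joinTransition p q Q) a b =
      if (a : ℕ) = 0 then
        -∑ c ∈ Finset.range (b : ℕ), P (c + 1) * Q ((b : ℕ) - c)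
      else if (a : ℕ) ≤ p ∧ (a : ℕ) ≤ (b : ℕ) then -Q ((b : ℕ) + 1 - (a : ℕ)) else 0 := by
  rw [Matrix.mul_apply]
  have hb := b.2
  have ha := a.2
  split_ifs with h0 h1
  · have key (c : Fin (p + q)) : joinedCompanion p q P Q a c * joinTransition p q Q c b =
        (fun c : ℕ => if c < (b : ℕ) then -(P (c + 1) * Q ((b : ℕ) - c)) else 0) c := by
      simp only [joinedCompanion, joinTransition, Matrix.of_apply]
      by_cases h2 : (c : ℕ) < p
      · have h3 : ¬ ((a : ℕ) = p ∧ p ≤ (c : ℕ)) := by omega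
        rw [if_pos ⟨h0, h2⟩, if_neg h3, if_neg (by omega : ¬ (a : ℕ) = (c : ℕ) + 1)]
        by_cases h4 : (c : ℕ) < (b : ℕ)
        · rw [if_pos ⟨h2, h4⟩, if_pos h4, add_zero, add_zero, mul_neg]
        · rw [if_neg (fun h => h4 h.2), if_neg h4, mul_zero]
      · simp [h2, hP ((c : ℕ) + 1) (by omega)]
    simp only [key]
    rw [Fin.sum_univ_eq_sum_range
      (fun c : ℕ => if c < (b : ℕ) then -(P (c + 1) * Q ((b : ℕ) - c)) else 0) (p + q),
      ← Finset.sum_neg_distrib, ← Finset.sum_filter]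
    congr 1
    ext c
    simp only [Finset.mem_filter, Finset.mem_range]
    omega
  · rw [Finset.sum_eq_single ⟨(a : ℕ) - 1, by omega⟩]
    · have e1 : (a : ℕ) = (a : ℕ) - 1 + 1 := by omega
      have e2 : ¬ ((a : ℕ) = p ∧ p ≤ (a : ℕ) - 1) := by omega
      have e3 : (a : ℕ) - 1 < p ∧ (a : ℕ) - 1 < (b : ℕ) := by omega
      have e4 : (b : ℕ) + 1 - (a : ℕ) = (b : ℕ) - ((a : ℕ) - 1) := by omega
      simp only [joinedCompanion, joinTransition, Matrix.of_apply, h0, false_and, if_false,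
        if_pos e1, if_neg e2, if_pos e3, e4, zero_add, add_zero, one_mul]
    · intro c _ hc
      have e1 : (a : ℕ) ≠ (c : ℕ) + 1 := fun h => hc (Fin.ext (by simp [h]))
      by_cases e2 : (c : ℕ) < p
      · have e3 : ¬ ((a : ℕ) = p ∧ p ≤ (c : ℕ)) := by omega
        simp only [joinedCompanion, Matrix.of_apply, h0, false_and, if_false, if_neg e1,
          if_neg e3, add_zero, zero_mul]
      · simp [joinTransition, e2]
    · simp
  · refine Finset.sum_eq_zero fun c _ => ?_
    by_cases e2 : (c : ℕ) < p ∧ (c : ℕ) < (b : ℕ)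
    · have e1 : (a : ℕ) ≠ (c : ℕ) + 1 := by omega
      have e3 : ¬ ((a : ℕ) = p ∧ p ≤ (c : ℕ)) := by omega
      simp only [joinedCompanion, Matrix.of_apply, h0, false_and, if_false, if_neg e1,
        if_neg e3, add_zero, zero_mul]
    · simp only [joinTransition, Matrix.of_apply, if_neg e2, mul_zero]

/-- The companion matrix of a product `(1 - P)(1 - Q)` is conjugate to a block triangular matrix
with the companion matrices of `P` and `Q` on the diagonal. -/
theorem companion_semiconj_joinedCompanion (hP0 : P 0 = 0) (hQ0 : Q 0 = 0)
    (hP : ∀ n, p < n → P n = 0) (hQ : ∀ n, q < n → Q n = 0) {s : ℕ → S}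
    (hs : ∀ n, s n = P n + Q n - ∑ x ∈ Finset.HasAntidiagonal.antidiagonal n, P x.1 * Q x.2) :
    (1 + joinTransition p q Q) * companion (p + q) s =
      joinedCompanion p q P Q * (1 + joinTransition p q Q) := by
  ext a b
  rw [add_mul, mul_add, one_mul, mul_one, Matrix.add_apply, Matrix.add_apply,
    joinTransition_mul_companion hQ, joinedCompanion_mul_joinTransition hP]
  -- Both end terms of the convolution vanish because `P 0 = Q 0 = 0`.
  have hsum : s ((b : ℕ) + 1) = P ((b : ℕ) + 1) + Q ((b : ℕ) + 1) -
      ∑ c ∈ Finset.range (b : ℕ), P (c + 1) * Q ((b : ℕ) - c) := by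
    rw [hs, Finset.Nat.sum_antidiagonal_eq_sum_range_succ (fun i j => P i * Q j),
      Finset.sum_range_succ', Finset.sum_range_succ]
    simp [hP0, hQ0]
  simp only [companion, joinedCompanion, Matrix.of_apply]
  by_cases h0 : (a : ℕ) = 0
  · rw [if_pos h0, if_pos h0, hsum, h0]
    -- For `p = 0` the rows `0` and `p` coincide, and the entries `Q` come from the last summand of
    -- `joinedCompanion`.
    rcases Nat.eq_zero_or_pos p with rfl | hp
    · have h1 : P ((b : ℕ) + 1) = 0 := hP _ (by omega)
      simp [h1]
      abel
    · have h1 : ¬ (0 = p ∧ p ≤ (b : ℕ)) := by omega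
      by_cases h2 : (b : ℕ) < p
      · simp [h1, h2, hp]
        abel
      · have h3 : P ((b : ℕ) + 1) = 0 := hP _ (by omega)
        simp [h1, h2, hp, h3]
        abel
  · simp only [h0, if_false, false_and, zero_add]
    rcases lt_trichotomy (a : ℕ) p with h1 | h1 | h1
    · simp [h1, h1.le, h1.ne]
    -- In row `p` the entries `Q` of `joinedCompanion` cancel against its product with
    -- `joinTransition`, leaving only the subdiagonal.
    · rw [h1]
      by_cases h2 : p ≤ (b : ℕ)
      · have h3 : (b : ℕ) + 1 - p = (b : ℕ) - p + 1 := by omega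
        simp [h2, h3]
      · simp [h2]
    · simp [h1.not_gt, h1.not_ge, h1.ne']

theorem isUnit_one_add_joinTransition (p q : ℕ) (Q : ℕ → S) :
    IsUnit (1 + joinTransition p q Q) := by
  refine isUnit_of_mem_elemMonoid
    (one_add_mem_elemMonoid_of_height (fun a : Fin (p + q) => p + q - (a : ℕ)) _ fun a b hab => ?_)
  have : (a : ℕ) < p ∧ (a : ℕ) < (b : ℕ) := by
    by_contra h
    exact hab (by simp only [joinTransition, Matrix.of_apply, if_neg h])
  have := b.2
  omega

end Companion

/-! ### Deleting a triangular factor from the joined companion matrix -/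

section BlockShiftClass

variable {R : Type u} [Ring R] {ι : Type v} [Fintype ι] [DecidableEq ι]

/-- The SSE class of a block matrix. -/
noncomputable def blockShiftClass {κ : Type w} [Fintype κ] (M : Matrix κ κ (Matrix ι ι R)) :
    SSEClasses R :=
  shiftClass (Matrix.comp κ κ ι ι R M)

/-- Conjugation is a single elementary strong shift equivalence: `M = (T⁻¹N)T` and `N = T(T⁻¹N)`. -/
theorem blockShiftClass_eq_of_semiconj {κ : Type w} [Fintype κ] [DecidableEq κ]
    {M N T : Matrix κ κ (Matrix ι ι R)} (hT : IsUnit T) (h : T * M = N * T) :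
    blockShiftClass M = blockShiftClass N := by
  obtain ⟨T, rfl⟩ := hT
  have hM : M = ((T⁻¹ : _ˣ).val * N) * T.val := by rw [mul_assoc, ← h, ← mul_assoc]; simp
  have hN : N = T.val * ((T⁻¹ : _ˣ).val * N) := by rw [← mul_assoc]; simp
  have key (A B : Matrix κ κ (Matrix ι ι R)) :
      blockShiftClass (A * B) = blockShiftClass (B * A) := by
    have hmul := (Matrix.compRingEquiv κ ι R).map_mul
    simp only [Matrix.compRingEquiv_apply] at hmul
    rw [blockShiftClass, blockShiftClass, hmul, hmul, shiftClass_mul_comm]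
  rw [hM, key, ← hN]

variable {p q : ℕ} {P Q : ℕ → Matrix ι ι R}

/-- Rows of the `P` part have nonzero entries only in its own columns. An entry either lowers the
block number by one or starts in block `0` and lowers `f`; the weight `p` on `f` outweighs any gain
in block number, which stays below `p`. -/
theorem blockShiftClass_joinedCompanion_left (f : ι → ℕ)
    (hf : ∀ n i j, P n i j ≠ 0 → f j < f i) :
    blockShiftClass (joinedCompanion p q P Q) = blockShiftClass (companion q Q) := by
  rw [blockShiftClass, shiftClass_submatrix_of_height_rows _
    (fun x : Fin q × ι => (Fin.natAdd p x.1, x.2)) ?_ (fun x => (x.1 : ℕ) + p * f x.2) ?_]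
  · rw [blockShiftClass]
    congr 1
    ext ⟨a, i⟩ ⟨b, j⟩
    by_cases ha : (a : ℕ) = 0
    · simp [joinedCompanion, companion, ha, Nat.add_assoc]
    · have h2 : p + (a : ℕ) = p + (b : ℕ) + 1 ↔ (a : ℕ) = (b : ℕ) + 1 := by omega
      simp [joinedCompanion, companion, ha, h2]
  · rintro ⟨a, i⟩ ⟨b, j⟩ h
    simpa [Fin.ext_iff] using h
  · rintro ⟨a, i⟩ hx ⟨b, j⟩ hM
    have hrange (x : Fin (p + q) × ι) :
        x ∉ Set.range (fun x : Fin q × ι => (Fin.natAdd p x.1, x.2)) ↔ (x.1 : ℕ) < p := by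
      obtain ⟨c, l⟩ := x
      refine Fin.addCases (fun c => ?_) (fun c => ?_) c
      · simp [Fin.ext_iff]
        intro d h
        have := c.2
        omega
      · simp
    rw [hrange] at hx ⊢
    simp only at hx ⊢
    have h1 : ¬ ((a : ℕ) = p ∧ p ≤ (b : ℕ)) := by omega
    simp only [Matrix.comp_apply, joinedCompanion, Matrix.of_apply, if_neg h1, add_zero] at hM
    by_cases h2 : (a : ℕ) = (b : ℕ) + 1
    · have h3 : ¬ ((a : ℕ) = 0 ∧ (b : ℕ) < p) := by omega
      rw [if_neg h3, if_pos h2, zero_add] at hM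
      have : i = j := by
        by_contra hij
        exact hM (Matrix.one_apply_ne hij)
      subst this
      constructor <;> omega
    · rw [if_neg h2, add_zero] at hM
      by_cases h3 : (a : ℕ) = 0 ∧ (b : ℕ) < p
      · rw [if_pos h3] at hM
        have := hf _ _ _ hM
        have : p * (f j + 1) ≤ p * f i := Nat.mul_le_mul_left _ this
        refine ⟨h3.2, ?_⟩
        rw [Nat.mul_add] at this
        omega
      · rw [if_neg h3] at hM
        exact absurd rfl hM

/-- Dually, columns of the `Q` part are reached only from its own rows, so it is deleted by columns,
with the order of blocks reversed in the height. -/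
theorem blockShiftClass_joinedCompanion_right (f : ι → ℕ)
    (hf : ∀ n i j, Q n i j ≠ 0 → f i < f j) :
    blockShiftClass (joinedCompanion p q P Q) = blockShiftClass (companion p P) := by
  rw [blockShiftClass, shiftClass_submatrix_of_height_cols _
    (fun x : Fin p × ι => (Fin.castAdd q x.1, x.2)) ?_
    (fun x => (p + q - 1 - (x.1 : ℕ)) + q * f x.2) ?_]
  · rw [blockShiftClass]
    congr 1
    ext ⟨a, i⟩ ⟨b, j⟩
    by_cases ha : (a : ℕ) = 0
    · have h2 : ¬ (0 = p ∧ p ≤ (b : ℕ)) := by omega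
      simp [joinedCompanion, companion, ha, h2]
    · have h2 : ¬ ((a : ℕ) = p ∧ p ≤ (b : ℕ)) := by omega
      simp [joinedCompanion, companion, ha, h2]
  · rintro ⟨a, i⟩ ⟨b, j⟩ h
    simpa [Fin.ext_iff] using h
  · rintro ⟨b, j⟩ hx ⟨a, i⟩ hM
    have hrange (x : Fin (p + q) × ι) :
        x ∉ Set.range (fun x : Fin p × ι => (Fin.castAdd q x.1, x.2)) ↔ p ≤ (x.1 : ℕ) := by
      obtain ⟨c, l⟩ := x
      refine Fin.addCases (fun c => ?_) (fun c => ?_) c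
      · simp
      · simp [Fin.ext_iff]
        intro d h
        have := d.2
        omega
    rw [hrange] at hx ⊢
    simp only at hx ⊢
    have hb := b.2
    have ha := a.2
    have h1 : ¬ ((a : ℕ) = 0 ∧ (b : ℕ) < p) := by omega
    simp only [Matrix.comp_apply, joinedCompanion, Matrix.of_apply, if_neg h1, zero_add] at hM
    by_cases h2 : (a : ℕ) = (b : ℕ) + 1
    · have h3 : ¬ ((a : ℕ) = p ∧ p ≤ (b : ℕ)) := by omega
      rw [if_neg h3, if_pos h2, add_zero] at hM
      have : i = j := by
        by_contra hij
        exact hM (Matrix.one_apply_ne hij)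
      subst this
      constructor <;> omega
    · rw [if_neg h2, zero_add] at hM
      by_cases h3 : (a : ℕ) = p ∧ p ≤ (b : ℕ)
      · rw [if_pos h3] at hM
        have := hf _ _ _ hM
        have : q * (f i + 1) ≤ q * f j := Nat.mul_le_mul_left _ this
        refine ⟨by omega, ?_⟩
        rw [Nat.mul_add] at this
        omega
      · rw [if_neg h3] at hM
        exact absurd rfl hM

end BlockShiftClass

/-! ### The SSE class of a polynomial matrix without constant term -/

section BoxClass

variable {R : Type u} [Ring R] {ι : Type v} [Fintype ι] [DecidableEq ι]

/-- The matrix of coefficients of `t ^ l`. -/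
def coeffMat (A : Matrix ι ι R[X]) (l : ℕ) : Matrix ι ι R :=
  Matrix.of fun i j => (A i j).coeff l

/-- The constant matrices over `R[t]`. -/
noncomputable def constMat : Matrix ι ι R →+* Matrix ι ι R[X] := C.mapMatrix

/-- Evaluation at `t = 0`. -/
noncomputable def evalZero : Matrix ι ι R[X] →+* Matrix ι ι R := constantCoeff.mapMatrix

theorem evalZero_constMat (M : Matrix ι ι R) : evalZero (constMat M) = M := by
  ext i j
  simp [evalZero, constMat]

theorem coeffMat_zero_eq (A : Matrix ι ι R[X]) : coeffMat A 0 = evalZero A := by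
  ext i j
  simp [coeffMat, evalZero, constantCoeff_apply]

theorem coeffMat_sub {ι : Type v} (A B : Matrix ι ι R[X]) (n : ℕ) :
    coeffMat (A - B) n = coeffMat A n - coeffMat B n := by
  ext i j
  simp [coeffMat]

theorem coeffMat_mul {ι : Type v} [Fintype ι] (A B : Matrix ι ι R[X]) (n : ℕ) :
    coeffMat (A * B) n =
      ∑ x ∈ Finset.HasAntidiagonal.antidiagonal n, coeffMat A x.1 * coeffMat B x.2 := by
  ext i j
  simp only [coeffMat, Matrix.of_apply, Matrix.mul_apply, Matrix.sum_apply, finsetSum_coeff,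
    coeff_mul]
  exact Finset.sum_comm

theorem coeffMat_constMat_mul (g : Matrix ι ι R) (A : Matrix ι ι R[X]) (n : ℕ) :
    coeffMat (constMat g * A) n = g * coeffMat A n := by
  ext i j
  simp [coeffMat, constMat, Matrix.mul_apply]

theorem coeffMat_mul_constMat (g : Matrix ι ι R) (A : Matrix ι ι R[X]) (n : ℕ) :
    coeffMat (A * constMat g) n = coeffMat A n * g := by
  ext i j
  simp [coeffMat, constMat, Matrix.mul_apply]

theorem coeffMat_eq_zero {ι : Type v} {A : Matrix ι ι R[X]} {k : ℕ} (hA : ∀ i j, (A i j).natDegree ≤ k)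
    (n : ℕ) (hn : k < n) : coeffMat A n = 0 := by
  ext i j
  exact coeff_eq_zero_of_natDegree_lt ((hA i j).trans_lt hn)

/-- The SSE class of the block companion matrix with `k × k` blocks of a polynomial matrix. -/
noncomputable def boxClass (k : ℕ) (A : Matrix ι ι R[X]) : SSEClasses R :=
  blockShiftClass (companion k (coeffMat A))

theorem boxClass_eq_joined {p q : ℕ} {P Q A : Matrix ι ι R[X]}
    (hP0 : evalZero P = 0) (hQ0 : evalZero Q = 0)
    (hP : ∀ i j, (P i j).natDegree ≤ p) (hQ : ∀ i j, (Q i j).natDegree ≤ q)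
    (h : (1 - P) * (1 - Q) = 1 - A) :
    boxClass (p + q) A = blockShiftClass (joinedCompanion p q (coeffMat P) (coeffMat Q)) := by
  refine blockShiftClass_eq_of_semiconj (isUnit_one_add_joinTransition p q (coeffMat Q))
    (companion_semiconj_joinedCompanion ?_ ?_ (coeffMat_eq_zero hP) (coeffMat_eq_zero hQ) ?_)
  · rw [coeffMat_zero_eq, hP0]
  · rw [coeffMat_zero_eq, hQ0]
  · intro n
    have hA : A = P - (P * Q - Q) := by
      have : A = 1 - (1 - P) * (1 - Q) := by rw [h]; abel
      rw [this]
      noncomm_ring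
    rw [← coeffMat_mul, hA, coeffMat_sub, coeffMat_sub]
    abel

theorem boxClass_mul_left {p q : ℕ} {P Q A : Matrix ι ι R[X]}
    (hP0 : evalZero P = 0) (hQ0 : evalZero Q = 0)
    (hP : ∀ i j, (P i j).natDegree ≤ p) (hQ : ∀ i j, (Q i j).natDegree ≤ q)
    (h : (1 - P) * (1 - Q) = 1 - A) (f : ι → ℕ) (hf : ∀ i j, P i j ≠ 0 → f j < f i) :
    boxClass (p + q) A = boxClass q Q := by
  rw [boxClass_eq_joined hP0 hQ0 hP hQ h]
  refine blockShiftClass_joinedCompanion_left f fun n i j hn => hf i j fun h0 => hn ?_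
  simp [coeffMat, h0]

theorem boxClass_mul_right {p q : ℕ} {P Q A : Matrix ι ι R[X]}
    (hP0 : evalZero P = 0) (hQ0 : evalZero Q = 0)
    (hP : ∀ i j, (P i j).natDegree ≤ p) (hQ : ∀ i j, (Q i j).natDegree ≤ q)
    (h : (1 - P) * (1 - Q) = 1 - A) (f : ι → ℕ) (hf : ∀ i j, Q i j ≠ 0 → f i < f j) :
    boxClass (p + q) A = boxClass p P := by
  rw [boxClass_eq_joined hP0 hQ0 hP hQ h]
  refine blockShiftClass_joinedCompanion_right f fun n i j hn => hf i j fun h0 => hn ?_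
  simp [coeffMat, h0]

/-- The factor `Q = 0`, given the generous degree bound `m`, absorbs the superfluous blocks;
independence of the number of blocks follows. -/
theorem boxClass_add {k : ℕ} {A : Matrix ι ι R[X]} (hA0 : evalZero A = 0)
    (hA : ∀ i j, (A i j).natDegree ≤ k) (m : ℕ) : boxClass (k + m) A = boxClass k A :=
  boxClass_mul_right (Q := 0) hA0 (map_zero _) hA (by simp) (by simp) (fun _ => 0) (by simp)

theorem boxClass_congr {k l : ℕ} {A : Matrix ι ι R[X]} (hA0 : evalZero A = 0)
    (hk : ∀ i j, (A i j).natDegree ≤ k) (hl : ∀ i j, (A i j).natDegree ≤ l) :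
    boxClass k A = boxClass l A := by
  rw [← boxClass_add hA0 hk l, add_comm, boxClass_add hA0 hl]

/-- The largest degree of an entry. -/
def degBound (A : Matrix ι ι R[X]) : ℕ :=
  Finset.univ.sup fun i => Finset.univ.sup fun j => (A i j).natDegree

theorem natDegree_le_degBound {ι : Type v} [Fintype ι] (A : Matrix ι ι R[X]) (i j : ι) : (A i j).natDegree ≤ degBound A :=
  (Finset.le_sup (f := fun j => (A i j).natDegree) (Finset.mem_univ j)).trans
    (Finset.le_sup (f := fun i => Finset.univ.sup fun j => (A i j).natDegree) (Finset.mem_univ i))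

/-- The SSE class attached to a matrix over `tR[t]`. -/
noncomputable def polyClass (A : Matrix ι ι R[X]) : SSEClasses R := boxClass (degBound A) A

theorem boxClass_eq_polyClass {k : ℕ} {A : Matrix ι ι R[X]} (hA0 : evalZero A = 0)
    (hk : ∀ i j, (A i j).natDegree ≤ k) : boxClass k A = polyClass A :=
  boxClass_congr hA0 hk (natDegree_le_degBound A)

theorem polyClass_mul_left {P Q A : Matrix ι ι R[X]}
    (hP0 : evalZero P = 0) (hQ0 : evalZero Q = 0) (hA0 : evalZero A = 0)
    (h : (1 - P) * (1 - Q) = 1 - A) (f : ι → ℕ) (hf : ∀ i j, P i j ≠ 0 → f j < f i) :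
    polyClass A = polyClass Q := by
  -- Padding the bound for `P` by `degBound A` makes the total bound the degrees of `A` without a
  -- degree estimate for the product.
  have h1 := boxClass_mul_left hP0 hQ0
    (fun i j => (natDegree_le_degBound P i j).trans (Nat.le_add_right _ (degBound A)))
    (natDegree_le_degBound Q) h f hf
  rwa [boxClass_eq_polyClass hA0 fun i j => (natDegree_le_degBound A i j).trans (by omega)] at h1

theorem polyClass_mul_right {P Q A : Matrix ι ι R[X]}
    (hP0 : evalZero P = 0) (hQ0 : evalZero Q = 0) (hA0 : evalZero A = 0)
    (h : (1 - P) * (1 - Q) = 1 - A) (f : ι → ℕ) (hf : ∀ i j, Q i j ≠ 0 → f i < f j) :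
    polyClass A = polyClass P := by
  have h1 := boxClass_mul_right hP0 hQ0 (natDegree_le_degBound P)
    (fun i j => (natDegree_le_degBound Q i j).trans (Nat.le_add_right _ (degBound A))) h f hf
  rwa [boxClass_eq_polyClass hA0 fun i j => (natDegree_le_degBound A i j).trans (by omega)] at h1

/-- The block diagonal matrix with `g` in every block intertwines the companion matrices, since `g`
commutes with the identity blocks and passes through each coefficient. -/
theorem polyClass_eq_of_constMat_semiconj {A B : Matrix ι ι R[X]} (hA0 : evalZero A = 0)
    (hB0 : evalZero B = 0) {g : Matrix ι ι R} (hg : IsUnit g)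
    (h : constMat g * A = B * constMat g) : polyClass A = polyClass B := by
  rw [← boxClass_eq_polyClass (k := degBound A + degBound B) hA0
      fun i j => (natDegree_le_degBound A i j).trans (by omega),
    ← boxClass_eq_polyClass (k := degBound A + degBound B) hB0
      fun i j => (natDegree_le_degBound B i j).trans (by omega)]
  refine blockShiftClass_eq_of_semiconj (hg.map (Matrix.scalar (Fin _))) ?_
  ext1 a b
  rw [Matrix.scalar_apply, Matrix.diagonal_mul, Matrix.mul_diagonal]
  simp only [companion, Matrix.of_apply]
  split_ifs
  · rw [← coeffMat_constMat_mul, h, coeffMat_mul_constMat]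
  all_goals simp

end BoxClass

/-! ### Invariance under elementary matrices over `R[t]` -/

section ElementaryInvariance

variable {R : Type u} [Ring R] {ι : Type v} [Fintype ι] [DecidableEq ι]

/-- The constant part of an invertible matrix over `R[t]`. -/
noncomputable def constPart : (Matrix ι ι R[X])ˣ →* (Matrix ι ι R[X])ˣ :=
  Units.map ((constMat : Matrix ι ι R →+* _).comp evalZero).toMonoidHom

theorem coe_constPart (U : (Matrix ι ι R[X])ˣ) :
    (constPart U : Matrix ι ι R[X]) = constMat (evalZero (U : Matrix ι ι R[X])) := rfl

theorem evalZero_constPart (U : (Matrix ι ι R[X])ˣ) :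
    evalZero (constPart U : Matrix ι ι R[X]) = evalZero (U : Matrix ι ι R[X]) := by
  rw [coe_constPart, evalZero_constMat]

theorem evalZero_isUnit (U : (Matrix ι ι R[X])ˣ) : IsUnit (evalZero (U : Matrix ι ι R[X])) :=
  U.isUnit.map evalZero

theorem polyClass_eq_of_constPart_semiconj {A B : Matrix ι ι R[X]} (hA0 : evalZero A = 0)
    (hB0 : evalZero B = 0) (U : (Matrix ι ι R[X])ˣ)
    (h : (constPart U : Matrix ι ι R[X]) * A = B * (constPart U : Matrix ι ι R[X])) :
    polyClass A = polyClass B :=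
  polyClass_eq_of_constMat_semiconj hA0 hB0 (evalZero_isUnit U) h

theorem evalZero_eq_zero_iff {A : Matrix ι ι R[X]} : evalZero A = 0 ↔ evalZero (1 - A) = 1 := by
  rw [map_sub, map_one, sub_eq_self]

theorem constPart_one_add_single {U : (Matrix ι ι R[X])ˣ} {i j : ι} {c : R[X]}
    (hU : (U : Matrix ι ι R[X]) = 1 + Matrix.single i j c) :
    (constPart U : Matrix ι ι R[X]) = 1 + Matrix.single i j (C (c.coeff 0)) := by
  rw [coe_constPart, hU, map_add, map_one, map_add, map_one]
  congr 1
  ext a b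
  simp only [constMat, evalZero, RingHom.mapMatrix_apply, Matrix.map_apply, Matrix.single_apply]
  split_ifs <;> simp [constantCoeff_apply]

theorem single_sub {S : Type u} [Ring S] {ι : Type v} [DecidableEq ι] (i j : ι) (a b : S) :
    Matrix.single i j (a - b) = Matrix.single i j a - Matrix.single i j b := by
  ext x y
  simp only [Matrix.single_apply, Matrix.sub_apply]
  split_ifs <;> simp

theorem evalZero_single {i j : ι} {c : R[X]} (hc : c.coeff 0 = 0) :
    evalZero (Matrix.single i j c) = 0 := by
  ext a b
  simp only [evalZero, RingHom.mapMatrix_apply, Matrix.map_apply, Matrix.single_apply]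
  split_ifs <;> simp [constantCoeff_apply, hc]

/-- The constant part on the right compensates for `U(1 - A)` not being `1` at `t = 0`. Writing `U =
(1 - P)g` with `g` constant and `P` a single off-diagonal entry without constant term gives `1 - B =
(1 - P)(1 - gAg⁻¹)`: a conjugation followed by a triangular factor. -/
theorem polyClass_eq_of_single_mul {U : (Matrix ι ι R[X])ˣ} {i j : ι} (hij : i ≠ j) {c : R[X]}
    (hU : (U : Matrix ι ι R[X]) = 1 + Matrix.single i j c) {A B : Matrix ι ι R[X]}
    (hA : evalZero A = 0) (hB : evalZero B = 0)
    (h : (U : Matrix ι ι R[X]) * (1 - A) = (1 - B) * (constPart U : Matrix ι ι R[X])) :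
    polyClass A = polyClass B := by
  set g := constPart U with hg
  set A' : Matrix ι ι R[X] := (g : Matrix ι ι R[X]) * A * (g⁻¹ : _ˣ).val with hA'
  have hA'0 : evalZero A' = 0 := by simp [hA', hA]
  rw [polyClass_eq_of_constPart_semiconj hA hA'0 U (by simp [hA', ← hg, mul_assoc])]
  have hfac : (U : Matrix ι ι R[X]) = (1 - Matrix.single i j (C (c.coeff 0) - c)) * g := by
    rw [hU, hg, constPart_one_add_single hU, sub_mul, one_mul, mul_add,
      Matrix.single_mul_single_of_ne _ _ _ _ hij.symm, mul_one, add_zero, add_sub_assoc,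
      ← single_sub, sub_sub_cancel]
  refine (polyClass_mul_left (P := Matrix.single i j (C (c.coeff 0) - c))
    (evalZero_single (by simp)) hA'0 hB ?_ (fun a => if a = i then 1 else 0) ?_).symm
  · have : 1 - A' = (g : Matrix ι ι R[X]) * (1 - A) * (g⁻¹ : _ˣ).val := by
      rw [hA', mul_sub, sub_mul, mul_one, Units.mul_inv]
    rw [this, ← mul_assoc, ← mul_assoc, ← hfac, h, mul_assoc, Units.mul_inv, mul_one]
  · intro a b hab
    have : i = a ∧ j = b := by
      by_contra h0
      exact hab (by rw [Matrix.single_apply, if_neg h0])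
    obtain ⟨rfl, rfl⟩ := this
    simp [hij.symm]

theorem polyClass_eq_of_mul_single {V : (Matrix ι ι R[X])ˣ} {i j : ι} (hij : i ≠ j) {c : R[X]}
    (hV : (V : Matrix ι ι R[X]) = 1 + Matrix.single i j c) {A B : Matrix ι ι R[X]}
    (hA : evalZero A = 0) (hB : evalZero B = 0)
    (h : (1 - A) * (V : Matrix ι ι R[X]) = (constPart V : Matrix ι ι R[X]) * (1 - B)) :
    polyClass A = polyClass B := by
  set g := constPart V with hg
  set A' : Matrix ι ι R[X] := (g⁻¹ : _ˣ).val * A * (g : Matrix ι ι R[X]) with hA'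
  have hA'0 : evalZero A' = 0 := by simp [hA', hA]
  rw [← polyClass_eq_of_constPart_semiconj hA'0 hA V (by simp [hA', ← hg, ← mul_assoc])]
  have hfac : (V : Matrix ι ι R[X]) = g * (1 - Matrix.single i j (C (c.coeff 0) - c)) := by
    rw [hV, hg, constPart_one_add_single hV, mul_sub, mul_one, add_mul,
      Matrix.single_mul_single_of_ne _ _ _ _ hij.symm, one_mul, add_zero, add_sub_assoc,
      ← single_sub, sub_sub_cancel]
  refine (polyClass_mul_right (Q := Matrix.single i j (C (c.coeff 0) - c)) hA'0
    (evalZero_single (by simp)) hB ?_ (fun a => if a = j then 1 else 0) ?_).symm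
  · have : 1 - A' = (g⁻¹ : _ˣ).val * (1 - A) * (g : Matrix ι ι R[X]) := by
      rw [hA', mul_sub, sub_mul, mul_one, Units.inv_mul]
    rw [this, mul_assoc, ← hfac, mul_assoc, h, ← mul_assoc, Units.inv_mul, one_mul]
  · intro a b hab
    have : i = a ∧ j = b := by
      by_contra h0
      exact hab (by rw [Matrix.single_apply, if_neg h0])
    obtain ⟨rfl, rfl⟩ := this
    simp [hij]

/-- The relation twisted by `constPart` composes and inverts, because `constPart` is a homomorphism;
this allows induction over generators. -/
theorem polyClass_eq_of_El_mul {n : ℕ} {U : (Matrix (Fin n) (Fin n) R[X])ˣ}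
    (hU : U ∈ El R[X] n) {A B : Matrix (Fin n) (Fin n) R[X]}
    (hA : evalZero A = 0) (hB : evalZero B = 0)
    (h : U.val * (1 - A) = (1 - B) * (constPart U).val) : polyClass A = polyClass B := by
  induction hU using Subgroup.closure_induction generalizing A B with
  | mem x hx =>
    obtain ⟨i, j, hij, c, hx⟩ := hx
    exact polyClass_eq_of_single_mul hij hx hA hB h
  | one =>
    have : A = B := by simpa using h
    rw [this]
  | inv x _ ih =>
    refine (ih hB hA ?_).symm
    rw [map_inv] at h
    calc x.val * (1 - B) = x.val * ((1 - B) * (constPart x)⁻¹.val) * (constPart x).val := by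
          simp [mul_assoc]
      _ = (1 - A) * (constPart x).val := by rw [← h]; simp [← mul_assoc]
  | mul x y _ _ hx hy =>
    rw [map_mul, Units.val_mul, Units.val_mul] at h
    let D := 1 - y.val * (1 - A) * (constPart y)⁻¹.val
    have h1 : 1 - D = y.val * (1 - A) * (constPart y)⁻¹.val := by simp [D]
    have hD : evalZero D = 0 := by
      rw [evalZero_eq_zero_iff, h1, map_mul, map_mul, evalZero_eq_zero_iff.1 hA, mul_one,
        ← evalZero_constPart, ← map_mul, Units.mul_inv, map_one]
    rw [hy hA hD (by rw [h1]; simp [mul_assoc])]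
    refine hx hD hB ?_
    calc x.val * (1 - D) = x.val * y.val * (1 - A) * (constPart y)⁻¹.val := by
          rw [h1]; simp only [mul_assoc]
      _ = _ := by rw [h]; simp [mul_assoc]

theorem polyClass_eq_of_mul_El {n : ℕ} {V : (Matrix (Fin n) (Fin n) R[X])ˣ}
    (hV : V ∈ El R[X] n) {A B : Matrix (Fin n) (Fin n) R[X]}
    (hA : evalZero A = 0) (hB : evalZero B = 0)
    (h : (1 - A) * V.val = (constPart V).val * (1 - B)) : polyClass A = polyClass B := by
  induction hV using Subgroup.closure_induction generalizing A B with
  | mem x hx =>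
    obtain ⟨i, j, hij, c, hx⟩ := hx
    exact polyClass_eq_of_mul_single hij hx hA hB h
  | one =>
    have : A = B := by simpa using h
    rw [this]
  | inv x _ ih =>
    refine (ih hB hA ?_).symm
    rw [map_inv] at h
    calc (1 - B) * x.val = (constPart x).val * ((constPart x)⁻¹.val * (1 - B)) * x.val := by
          simp [← mul_assoc]
      _ = (constPart x).val * (1 - A) := by rw [← h]; simp [mul_assoc]
  | mul x y _ _ hx hy =>
    rw [map_mul, Units.val_mul, Units.val_mul] at h
    let D := 1 - (constPart x)⁻¹.val * (1 - A) * x.val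
    have h1 : 1 - D = (constPart x)⁻¹.val * (1 - A) * x.val := by simp [D]
    have hD : evalZero D = 0 := by
      rw [evalZero_eq_zero_iff, h1, map_mul, map_mul, evalZero_eq_zero_iff.1 hA, mul_one,
        ← evalZero_constPart x, ← map_mul, Units.inv_mul, map_one]
    rw [hx hA hD (by rw [h1]; simp [← mul_assoc])]
    refine hy hD hB ?_
    calc (1 - D) * y.val = (constPart x)⁻¹.val * ((1 - A) * (x.val * y.val)) := by
          rw [h1]; simp only [mul_assoc]
      _ = _ := by rw [h]; simp [← mul_assoc]

/-- With `U₀`, `V₀` the constant parts, setting `t = 0` gives `U₀V₀ = 1`. Put `1 - D = (1 - A)VU₀`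
and `1 - E = U₀(1 - A)V`. Then `A` and `E` differ by a right multiplication, `D` and `B` by a left
one, and `D`, `E` are conjugate under `U₀`. -/
theorem polyClass_eq_of_El_mul_El {n : ℕ} {U V : (Matrix (Fin n) (Fin n) R[X])ˣ}
    (hU : U ∈ El R[X] n) (hV : V ∈ El R[X] n) {A B : Matrix (Fin n) (Fin n) R[X]}
    (hA : evalZero A = 0) (hB : evalZero B = 0)
    (h : U.val * (1 - A) * V.val = 1 - B) : polyClass A = polyClass B := by
  have hUV : constPart U * constPart V = 1 := by
    ext1
    rw [Units.val_mul, coe_constPart, coe_constPart, ← map_mul]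
    have := congrArg evalZero h
    rw [map_mul, map_mul, evalZero_eq_zero_iff.1 hA, evalZero_eq_zero_iff.1 hB, mul_one] at this
    rw [this, map_one, Units.val_one]
  have hVU : (constPart V)⁻¹ = constPart U := inv_eq_of_mul_eq_one_left hUV
  let D := 1 - (1 - A) * V.val * (constPart U).val
  have h1 : 1 - D = (1 - A) * V.val * (constPart U).val := by simp [D]
  let E := 1 - (constPart U).val * (1 - A) * V.val
  have h2 : 1 - E = (constPart U).val * (1 - A) * V.val := by simp [E]
  have h0 : evalZero (constPart U).val * evalZero V.val = 1 := by
    rw [← evalZero_constPart V, ← map_mul, ← Units.val_mul, hUV, Units.val_one, map_one]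
  have h0' : evalZero V.val * evalZero (constPart U).val = 1 := by
    rw [← evalZero_constPart V, ← map_mul, ← Units.val_mul, ← hVU, mul_inv_cancel, Units.val_one,
      map_one]
  have hD : evalZero D = 0 := by
    rw [evalZero_eq_zero_iff, h1, map_mul, map_mul, evalZero_eq_zero_iff.1 hA, one_mul, h0']
  have hE : evalZero E = 0 := by
    rw [evalZero_eq_zero_iff, h2, map_mul, map_mul, evalZero_eq_zero_iff.1 hA, mul_one, h0]
  have e1 : polyClass A = polyClass E := by
    refine polyClass_eq_of_mul_El hV hA hE ?_
    rw [h2, ← hVU]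
    simp [← mul_assoc]
  have e2 : polyClass D = polyClass B := by
    refine polyClass_eq_of_El_mul hU hD hB ?_
    rw [h1, ← h]
    simp only [mul_assoc]
  have e3 : polyClass D = polyClass E := by
    refine polyClass_eq_of_constPart_semiconj hD hE U ?_
    simp only [D, E, mul_sub, sub_mul, mul_one, one_mul, mul_assoc]
  rw [e1, ← e3, e2]

end ElementaryInvariance

/-! ### Independence of the size, and comparison with `box` -/

section Stabilization

variable {R : Type u} [Ring R]

theorem evalZero_eq_zero_of_overT {n : ℕ} {A : Matrix (Fin n) (Fin n) R[X]} (hA : OverT A) :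
    evalZero A = 0 := by
  ext i j
  exact X_dvd_iff.1 (hA i j)

theorem overT_st0 {n : ℕ} {A : Matrix (Fin n) (Fin n) R[X]} (hA : OverT A) (N : ℕ) :
    OverT (st0 N A) := by
  intro i j
  simp only [st0, Matrix.of_apply]
  split_ifs
  · exact hA _ _
  · exact dvd_zero _

theorem natDegree_st0_le {n : ℕ} {A : Matrix (Fin n) (Fin n) R[X]} {k : ℕ}
    (hk : ∀ i j, (A i j).natDegree ≤ k) (N : ℕ) (i j : Fin N) :
    (st0 N A i j).natDegree ≤ k := by
  simp only [st0, Matrix.of_apply]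
  split_ifs
  · exact hk _ _
  · simp

theorem st1_one_sub {S : Type u} [Ring S] {n : ℕ} (N : ℕ) (A : Matrix (Fin n) (Fin n) S) :
    st1 N (1 - A) = 1 - st0 N A := by
  ext i j
  simp only [st1, st0, Matrix.of_apply, Matrix.sub_apply, Matrix.one_apply, Fin.ext_iff]
  split_ifs <;> simp

/-- At the added positions only the identity blocks survive in the rows, and these lower the block
number, which thus serves as height. -/
theorem boxClass_st0 {n N : ℕ} (h : n ≤ N) (k : ℕ) (A : Matrix (Fin n) (Fin n) R[X]) :
    boxClass k (st0 N A) = boxClass k A := by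
  rw [boxClass, blockShiftClass, shiftClass_submatrix_of_height_rows _
    (fun x : Fin k × Fin n => (x.1, Fin.castLE h x.2)) ?_ (fun x => (x.1 : ℕ)) ?_]
  · rw [boxClass, blockShiftClass]
    congr 1
    ext ⟨a, i⟩ ⟨b, j⟩
    simp only [Matrix.submatrix_apply, Matrix.comp_apply, companion, Matrix.of_apply]
    split_ifs
    · simp [coeffMat, st0]
    · simp [Matrix.one_apply]
    · rfl
  · rintro ⟨a, i⟩ ⟨b, j⟩ h
    simpa [Fin.ext_iff] using h
  · have hrange (x : Fin k × Fin N) :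
        x ∉ Set.range (fun x : Fin k × Fin n => (x.1, Fin.castLE h x.2)) ↔ n ≤ (x.2 : ℕ) := by
      rw [← not_lt, not_iff_not]
      constructor
      · rintro ⟨y, rfl⟩
        exact y.2.2
      · exact fun hx => ⟨(x.1, ⟨x.2, hx⟩), rfl⟩
    rintro ⟨a, i⟩ hx ⟨b, j⟩ hM
    rw [hrange] at hx ⊢
    simp only [Matrix.comp_apply, companion, Matrix.of_apply] at hM hx ⊢
    split_ifs at hM with h0 h1
    · have : ¬ ((i : ℕ) < n ∧ (j : ℕ) < n) := by omega
      simp [coeffMat, st0, this] at hM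
    · have : i = j := by
        by_contra hij
        exact hM (Matrix.one_apply_ne hij)
      subst this
      exact ⟨hx, by omega⟩
    · exact absurd rfl hM

theorem polyClass_st0 {n N : ℕ} (h : n ≤ N) {A : Matrix (Fin n) (Fin n) R[X]} (hA : OverT A) :
    polyClass (st0 N A) = polyClass A := by
  rw [← boxClass_eq_polyClass (evalZero_eq_zero_of_overT (overT_st0 hA N))
    (natDegree_st0_le (natDegree_le_degBound A) N), boxClass_st0 h, polyClass]

theorem polyClass_eq_of_elEquiv {n m : ℕ} {A : Matrix (Fin n) (Fin n) R[X]}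
    {B : Matrix (Fin m) (Fin m) R[X]} (hA : OverT A) (hB : OverT B)
    (h : ElEquiv (1 - A) (1 - B)) : polyClass A = polyClass B := by
  obtain ⟨N, hn, hm, U, hU, V, hV, e⟩ := h
  rw [st1_one_sub, st1_one_sub] at e
  rw [← polyClass_st0 hn hA, ← polyClass_st0 hm hB]
  exact polyClass_eq_of_El_mul_El hU hV (evalZero_eq_zero_of_overT (overT_st0 hA N))
    (evalZero_eq_zero_of_overT (overT_st0 hB N)) e

theorem sseClass_box (k : ℕ) {n : ℕ} (A : Matrix (Fin n) (Fin n) R[X]) :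
    sseClass (box k A) = boxClass k A := by
  rw [boxClass, blockShiftClass, shiftClass_eq_sseClass finProdFinEquiv.symm]
  congr 1
  ext x y
  simp only [box, Matrix.reindex_apply, Matrix.submatrix_apply, Matrix.comp_apply, companion,
    Matrix.of_apply]
  by_cases h0 : ((finProdFinEquiv.symm x).1 : ℕ) = 0
  · rw [if_pos h0, if_pos h0]
    rfl
  · rw [if_neg h0, if_neg h0]
    by_cases h1 : ((finProdFinEquiv.symm x).1 : ℕ) = ((finProdFinEquiv.symm y).1 : ℕ) + 1
    · simp only [h1, true_and, if_true, Matrix.one_apply]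
    · simp only [h1, false_and, if_false, Matrix.zero_apply]

theorem polyClass_eq_sseClass_box {n k N : ℕ} {A : Matrix (Fin n) (Fin n) R[X]} (hA : OverT A)
    (hk : ∀ i j, (A i j).natDegree ≤ k) (hN : n ≤ N) :
    polyClass A = sseClass (box k (st0 N A)) := by
  rw [sseClass_box, boxClass_st0 hN, boxClass_eq_polyClass (evalZero_eq_zero_of_overT hA) hk]

/-- Taking `k = 1`, the companion matrix is reduced to its single block `A`. -/
theorem polyClass_tMul {n : ℕ} (A : Matrix (Fin n) (Fin n) R) :
    polyClass (tMul A) = sseClass A := by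
  have hdeg (i j) : (tMul A i j).natDegree ≤ 1 := by
    rw [tMul, Matrix.map_apply]
    exact (natDegree_mul_C_le _ _).trans natDegree_X_le
  rw [← boxClass_eq_polyClass (evalZero_eq_zero_of_overT (overT_tMul A)) hdeg, boxClass,
    blockShiftClass, shiftClass_eq_sseClass (Equiv.uniqueProd (Fin n) (Fin 1)).symm]
  congr 1
  ext i j
  simp [companion, coeffMat, tMul]

end Stabilization

/-! ### Stable elementary equivalence of `1 - UV` and `1 - VU` -/

section StableClass

variable {S : Type u} [Ring S]

/-- `El(S)` equivalence on all square matrices. -/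
def elEquivSetoid (S : Type u) [Ring S] : Setoid (SqMat S) where
  r M M' := ElEquiv M.2 M'.2
  iseqv := ⟨fun M => ElEquiv.refl M.2, ElEquiv.symm, ElEquiv.trans⟩

/-- The `El(S)` equivalence class of `1 - A`, for `A` indexed by an arbitrary finite type. -/
noncomputable def stableClass {ι : Type v} [Fintype ι] (A : Matrix ι ι S) :
    Quotient (elEquivSetoid S) :=
  Quotient.mk (elEquivSetoid S) ⟨Fintype.card ι,
    1 - A.submatrix (Fintype.equivFin ι).symm (Fintype.equivFin ι).symm⟩

/-- `A` placed in the rows and columns singled out by `e`, with zeros elsewhere. -/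
def extendMat {ι : Type v} {κ : Type w} [DecidableEq κ] [Fintype ι] (e : ι → κ)
    (A : Matrix ι ι S) : Matrix κ κ S :=
  (1 : Matrix κ κ S).submatrix id e * A * (1 : Matrix κ κ S).submatrix e id

theorem submatrix_one_mul_self {ι : Type v} {κ : Type w} [DecidableEq κ] [DecidableEq ι]
    [Fintype κ] {e : ι → κ} (he : Function.Injective e) :
    (1 : Matrix κ κ S).submatrix e id * (1 : Matrix κ κ S).submatrix id e = 1 := by
  ext a b
  simp [Matrix.mul_apply, Matrix.one_apply, he.eq_iff]

theorem submatrix_one_mul_of_disjoint {ι κ μ : Type*} [DecidableEq κ] [Fintype κ]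
    {e : ι → κ} {f : μ → κ} (h : ∀ a b, e a ≠ f b) :
    (1 : Matrix κ κ S).submatrix e id * (1 : Matrix κ κ S).submatrix id f = 0 := by
  ext a b
  simp [Matrix.mul_apply, Matrix.one_apply, h a b]

theorem extendMat_castLE {n N : ℕ} (h : n ≤ N) (A : Matrix (Fin n) (Fin n) S) :
    extendMat (Fin.castLE h) A = st0 N A := by
  have hne (i : Fin N) (hi : ¬ (i : ℕ) < n) (a : Fin n) : i ≠ Fin.castLE h a := by
    rintro rfl
    exact hi a.2
  ext i j
  simp only [extendMat, st0, Matrix.mul_apply, Matrix.of_apply, Matrix.submatrix_apply]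
  by_cases hi : (i : ℕ) < n
  · obtain ⟨i, rfl⟩ : ∃ a, i = Fin.castLE h a := ⟨⟨i, hi⟩, rfl⟩
    by_cases hj : (j : ℕ) < n
    · obtain ⟨j, rfl⟩ : ∃ a, j = Fin.castLE h a := ⟨⟨j, hj⟩, rfl⟩
      simp [Matrix.one_apply]
    · have h1 : ¬ ((Fin.castLE h i : ℕ) < n ∧ (j : ℕ) < n) := by omega
      rw [dif_neg h1]
      exact Finset.sum_eq_zero fun a _ => mul_eq_zero_of_right _
        (Matrix.one_apply_ne (hne j hj a).symm)
  · have h1 : ¬ ((i : ℕ) < n ∧ (j : ℕ) < n) := by omega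
    rw [dif_neg h1]
    exact Finset.sum_eq_zero fun a _ => mul_eq_zero_of_left (Finset.sum_eq_zero fun b _ =>
      mul_eq_zero_of_left (Matrix.one_apply_ne (hne i hi b)) _) _

/-- Two matrices of the same size are related by left and right multiplication with products of
elementary matrices. -/
def ElemRel {κ : Type v} [Fintype κ] [DecidableEq κ] (M N : Matrix κ κ S) : Prop :=
  ∃ E ∈ elemMonoid κ S, ∃ F ∈ elemMonoid κ S, E * M * F = N

theorem ElemRel.trans {κ : Type v} [Fintype κ] [DecidableEq κ] {M N L : Matrix κ κ S}
    (h : ElemRel M N) (h' : ElemRel N L) : ElemRel M L := by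
  obtain ⟨E, hE, F, hF, rfl⟩ := h
  obtain ⟨E', hE', F', hF', rfl⟩ := h'
  exact ⟨E' * E, mul_mem hE' hE, F * F', mul_mem hF hF', by simp only [mul_assoc]⟩

/-- Let `X` and `Y` be `U` and `V` placed as off-diagonal blocks between the two disjoint index
sets. Then `X² = Y² = 0`, the matrices `1 ± X` and `1 ± Y` are elementary products, and both `1 -
XY` and `1 - YX` reduce to `1 + X + Y`. -/
theorem elemRel_extendMat {ι : Type*} {μ : Type*} {κ : Type v} [Fintype ι] [Fintype μ] [Fintype κ]
    [DecidableEq κ] {e : ι → κ} {f : μ → κ} (he : Function.Injective e)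
    (hf : Function.Injective f) (h : ∀ a b, e a ≠ f b) (U : Matrix ι μ S) (V : Matrix μ ι S) :
    ElemRel (1 - extendMat e (U * V)) (1 - extendMat f (V * U)) := by
  classical
  set P := (1 : Matrix κ κ S).submatrix id e
  set P' := (1 : Matrix κ κ S).submatrix e id
  set Q := (1 : Matrix κ κ S).submatrix id f
  set Q' := (1 : Matrix κ κ S).submatrix f id
  have hPP : P' * P = 1 := submatrix_one_mul_self he
  have hQQ : Q' * Q = 1 := submatrix_one_mul_self hf
  have hPQ : P' * Q = 0 := submatrix_one_mul_of_disjoint h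
  have hQP : Q' * P = 0 := submatrix_one_mul_of_disjoint fun a b => (h b a).symm
  set X := P * U * Q' with hX
  set Y := Q * V * P' with hY
  have hXX : X * X = 0 := by
    have : X * X = P * U * (Q' * P) * U * Q' := by simp only [hX, Matrix.mul_assoc]
    rw [this, hQP]
    simp
  have hYY : Y * Y = 0 := by
    have : Y * Y = Q * V * (P' * Q) * V * P' := by simp only [hY, Matrix.mul_assoc]
    rw [this, hPQ]
    simp
  have hXY : extendMat e (U * V) = X * Y := by
    have : X * Y = P * U * (Q' * Q) * V * P' := by simp only [hX, hY, Matrix.mul_assoc]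
    rw [this, hQQ, Matrix.mul_one]
    simp only [extendMat, P, P', Matrix.mul_assoc]
  have hYX : extendMat f (V * U) = Y * X := by
    have : Y * X = Q * V * (P' * P) * U * Q' := by simp only [hX, hY, Matrix.mul_assoc]
    rw [this, hPP, Matrix.mul_one]
    simp only [extendMat, Q, Q', Matrix.mul_assoc]
  have hPe (x a) (hx : P x a ≠ 0) : x = e a := by
    by_contra hne
    exact hx (Matrix.one_apply_ne hne)
  have hQf (x a) (hx : Q x a ≠ 0) : x = f a := by
    by_contra hne
    exact hx (Matrix.one_apply_ne hne)
  have hPe' (a x) (hx : P' a x ≠ 0) : x = e a := by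
    by_contra hne
    exact hx (Matrix.one_apply_ne (Ne.symm hne))
  have hQf' (a x) (hx : Q' a x ≠ 0) : x = f a := by
    by_contra hne
    exact hx (Matrix.one_apply_ne (Ne.symm hne))
  have hXs (i j) (hij : X i j ≠ 0) : i ∈ Set.range e ∧ j ∈ Set.range f := by
    rw [hX, Matrix.mul_apply] at hij
    obtain ⟨a, _, ha⟩ := Finset.exists_ne_zero_of_sum_ne_zero hij
    refine ⟨?_, a, (hQf' a j (right_ne_zero_of_mul ha)).symm⟩
    have h1 := left_ne_zero_of_mul ha
    rw [Matrix.mul_apply] at h1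
    obtain ⟨b, _, hb⟩ := Finset.exists_ne_zero_of_sum_ne_zero h1
    exact ⟨b, (hPe i b (left_ne_zero_of_mul hb)).symm⟩
  have hYs (i j) (hij : Y i j ≠ 0) : i ∈ Set.range f ∧ j ∈ Set.range e := by
    rw [hY, Matrix.mul_apply] at hij
    obtain ⟨a, _, ha⟩ := Finset.exists_ne_zero_of_sum_ne_zero hij
    refine ⟨?_, a, (hPe' a j (right_ne_zero_of_mul ha)).symm⟩
    have h1 := left_ne_zero_of_mul ha
    rw [Matrix.mul_apply] at h1
    obtain ⟨b, _, hb⟩ := Finset.exists_ne_zero_of_sum_ne_zero h1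
    exact ⟨b, (hQf i b (left_ne_zero_of_mul hb)).symm⟩
  have hdisj (x) : x ∈ Set.range e → x ∉ Set.range f := by
    rintro ⟨a, rfl⟩ ⟨b, hb⟩
    exact h a b hb.symm
  have hXp : 1 + X ∈ elemMonoid κ S :=
    one_add_mem_elemMonoid_of_support (· ∉ Set.range f) X fun i j hij =>
      ⟨hdisj i (hXs i j hij).1, not_not.2 (hXs i j hij).2⟩
  have hXm : 1 + -X ∈ elemMonoid κ S :=
    one_add_mem_elemMonoid_of_support (· ∉ Set.range f) (-X) fun i j hij =>
      ⟨hdisj i (hXs i j (neg_ne_zero.1 hij)).1, not_not.2 (hXs i j (neg_ne_zero.1 hij)).2⟩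
  have hYp : 1 + Y ∈ elemMonoid κ S :=
    one_add_mem_elemMonoid_of_support (· ∈ Set.range f) Y fun i j hij =>
      ⟨(hYs i j hij).1, hdisj j (hYs i j hij).2⟩
  have hYm : 1 + -Y ∈ elemMonoid κ S :=
    one_add_mem_elemMonoid_of_support (· ∈ Set.range f) (-Y) fun i j hij =>
      ⟨(hYs i j (neg_ne_zero.1 hij)).1, hdisj j (hYs i j (neg_ne_zero.1 hij)).2⟩
  have h1 : (1 + X) * (1 - X * Y) * (1 + Y) = 1 + X + Y := by
    have e1 : X * (X * Y) = 0 := by rw [← mul_assoc, hXX, zero_mul]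
    have e2 : X * Y * Y = 0 := by rw [mul_assoc, hYY, mul_zero]
    simp only [add_mul, mul_sub, mul_add, sub_mul, mul_one, one_mul, e1, e2]
    simp
  have h2 : (1 + -Y) * (1 + X + Y) * (1 + -X) = 1 - Y * X := by
    have e2 : Y * X * X = 0 := by rw [mul_assoc, hXX, mul_zero]
    simp only [add_mul, mul_add, mul_one, one_mul, neg_mul, mul_neg, hXX, hYY, e2, zero_mul]
    abel
  refine ⟨(1 + -Y) * (1 + X), mul_mem hYm hXp, (1 + Y) * (1 + -X), mul_mem hYp hXm, ?_⟩
  rw [hXY, hYX, ← h2, ← h1]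
  simp only [mul_assoc]

theorem ElemRel.elEquiv {n : ℕ} {M N : Matrix (Fin n) (Fin n) S} (h : ElemRel M N) :
    ElEquiv M N := by
  obtain ⟨E, hE, F, hF, rfl⟩ := h
  obtain ⟨U, hU, rfl⟩ := exists_mem_El_of_mem_elemMonoid hE
  obtain ⟨V, hV, rfl⟩ := exists_mem_El_of_mem_elemMonoid hF
  have hst (M : Matrix (Fin n) (Fin n) S) : st1 n M = M := by
    ext i j
    simp [st1]
  exact ⟨n, le_rfl, le_rfl, U, hU, V, hV, by rw [hst, hst]⟩

theorem elEquiv_st0 {n N : ℕ} (h : n ≤ N) (A : Matrix (Fin n) (Fin n) S) :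
    ElEquiv (1 - A) (1 - st0 N A) :=
  ⟨N, h, le_rfl, 1, one_mem _, 1, one_mem _, by
    rw [← st1_one_sub, st1_st1 h, Units.val_one, one_mul, mul_one]⟩

theorem elEquiv_one_sub_mul_comm {n m : ℕ} (U : Matrix (Fin n) (Fin m) S)
    (V : Matrix (Fin m) (Fin n) S) : ElEquiv (1 - U * V) (1 - V * U) := by
  have hn : n ≤ (n + m) + m := by omega
  have hm : m ≤ (n + m) + m := by omega
  -- The two upper left corners overlap, so `VU` is first created in the last `m` indices, disjoint
  -- from both, and then moved to the corner by the same lemma with the factors `VU` and `1`.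
  have h1 := elemRel_extendMat (Fin.castLE_injective hn) (Fin.natAdd_injective m (n + m))
    (fun a b hab => by
      have := congrArg Fin.val hab
      simp only [Fin.val_castLE, Fin.val_natAdd] at this
      omega) U V
  have h2 := elemRel_extendMat (Fin.natAdd_injective m (n + m)) (Fin.castLE_injective hm)
    (fun a b hab => by
      have := congrArg Fin.val hab
      simp only [Fin.val_castLE, Fin.val_natAdd] at this
      omega) (V * U) 1
  rw [mul_one, one_mul] at h2
  have h3 := (h1.trans h2).elEquiv
  rw [extendMat_castLE, extendMat_castLE] at h3
  exact ((elEquiv_st0 hn _).trans h3).trans (elEquiv_st0 hm _).symm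

theorem stableClass_mul_comm {ι : Type v} {κ : Type w} [Fintype ι] [Fintype κ]
    (U : Matrix ι κ S) (V : Matrix κ ι S) : stableClass (U * V) = stableClass (V * U) := by
  refine Quotient.sound ?_
  change ElEquiv (1 - (U * V).submatrix _ _) (1 - (V * U).submatrix _ _)
  rw [← Matrix.submatrix_mul_equiv U V _ (Fintype.equivFin κ).symm,
    ← Matrix.submatrix_mul_equiv V U _ (Fintype.equivFin ι).symm]
  exact elEquiv_one_sub_mul_comm _ _

theorem stableClass_submatrix {ι : Type v} {κ : Type w} [Fintype ι] [Fintype κ] (e : κ ≃ ι)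
    (A : Matrix ι ι S) : stableClass (A.submatrix e e) = stableClass A := by
  classical
  have h1 : A.submatrix e e = A.submatrix e id * (1 : Matrix ι ι S).submatrix id e := by
    rw [← Matrix.submatrix_mul _ _ _ id _ Function.bijective_id, mul_one]
  rw [h1, stableClass_mul_comm, Matrix.submatrix_mul_equiv, one_mul, Matrix.submatrix_id_id]

theorem stableClass_fin {n m : ℕ} {A : Matrix (Fin n) (Fin n) S} {B : Matrix (Fin m) (Fin m) S} :
    stableClass A = stableClass B ↔ ElEquiv (1 - A) (1 - B) := by
  have key (n : ℕ) (A : Matrix (Fin n) (Fin n) S) :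
      stableClass A = Quotient.mk (elEquivSetoid S) ⟨n, 1 - A⟩ := by
    set f := (Fintype.equivFin (Fin n)).symm
    refine Quotient.sound ?_
    change ElEquiv (1 - A.submatrix f f) (1 - A)
    have h1 : A.submatrix f f = A.submatrix f id * (1 : Matrix (Fin n) (Fin n) S).submatrix id f := by
      rw [← Matrix.submatrix_mul _ _ _ id _ Function.bijective_id, mul_one]
    have h2 : A = (1 : Matrix (Fin n) (Fin n) S).submatrix id f * A.submatrix f id := by
      rw [Matrix.submatrix_mul_equiv, one_mul, Matrix.submatrix_id_id]
    rw [h1]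
    conv_rhs => rw [h2]
    exact elEquiv_one_sub_mul_comm _ _
  rw [key, key]
  exact Quotient.eq

theorem stableClass_eq_of_mul_one_add {ι : Type v} [Fintype ι] [DecidableEq ι]
    {A B X : Matrix ι ι S} (hX : 1 + X ∈ elemMonoid ι S) (h : (1 - A) * (1 + X) = 1 - B) :
    stableClass A = stableClass B := by
  set f := (Fintype.equivFin ι).symm
  refine Quotient.sound (ElemRel.elEquiv ⟨1, one_mem _, (1 + X).submatrix f f,
    submatrix_mem_elemMonoid f hX, ?_⟩)
  have h1 (A : Matrix ι ι S) : 1 - A.submatrix f f = (1 - A).submatrix f f := by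
    rw [Matrix.submatrix_sub, Pi.sub_apply, Pi.sub_apply, Matrix.submatrix_one_equiv]
  change 1 * (1 - A.submatrix f f) * _ = 1 - B.submatrix f f
  rw [one_mul, h1, h1, Matrix.submatrix_mul_equiv, h]

theorem stableClass_zero (ι : Type v) (κ : Type w) [Fintype ι] [Fintype κ] :
    stableClass (0 : Matrix ι ι S) = stableClass (0 : Matrix κ κ S) := by
  simpa using stableClass_mul_comm (0 : Matrix ι κ S) (0 : Matrix κ ι S)

end StableClass

/-! ### Linearization over `R[t]` -/

section Linearization

variable {R : Type u} [Ring R] {ι : Type v} [Fintype ι] [DecidableEq ι]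

/-- Multiplication by `t`, for matrices over an arbitrary index type. -/
noncomputable def timesT (A : Matrix ι ι R) : Matrix ι ι R[X] := A.map fun a => X * C a

theorem coeff_divX_iterate (P : R[X]) (a n : ℕ) : (divX^[a] P).coeff n = P.coeff (n + a) := by
  induction a generalizing n with
  | zero => rfl
  | succ a ih => rw [Function.iterate_succ_apply', coeff_divX, ih, add_right_comm, add_assoc]

/-- Linearization: `1 - A` is stably equivalent to `1 - tA^□`. -/
theorem stableClass_timesT_companion {k : ℕ} {A : Matrix ι ι R[X]} (hA : evalZero A = 0)
    (hk : ∀ i j, (A i j).natDegree ≤ k) :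
    stableClass (timesT (Matrix.comp _ _ _ _ _ (companion k (coeffMat A)))) = stableClass A := by
  rcases Nat.eq_zero_or_pos k with rfl | hk0
  · have hA0 : A = 0 := by
      ext i j n
      rcases n with _ | n
      · exact congrFun (congrFun hA i) j
      · exact coeff_eq_zero_of_natDegree_lt ((hk i j).trans_lt (Nat.succ_pos n))
    rw [hA0, Subsingleton.elim (timesT _) 0]
    exact stableClass_zero _ _
  let o : Fin k := ⟨0, hk0⟩
  -- `J` includes the first block, `G` is the row of Horner tails of `A` multiplied by `t`, and `Y`
  -- is `t` times the block shift. Since `GJ = A`, the matrix `1 - JG` is stably equivalent to `1 -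
  -- A`; the factor `1 - Y` then turns the tails into single coefficients.
  let J : Matrix (Fin k × ι) ι R[X] := Matrix.of fun x j => if x = (o, j) then 1 else 0
  let G : Matrix ι (Fin k × ι) R[X] :=
    Matrix.of fun i y => X * divX^[(y.1 : ℕ) + 1] (A i y.2)
  let Y : Matrix (Fin k × ι) (Fin k × ι) R[X] :=
    Matrix.of fun x y => if (x.1 : ℕ) = (y.1 : ℕ) + 1 ∧ x.2 = y.2 then X else 0
  have hGJ : G * J = A := by
    ext1 i j
    have h0 : (A i j).coeff 0 = 0 := congrFun (congrFun hA i) j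
    have : X * divX (A i j) = A i j := by
      conv_rhs => rw [← divX_mul_X_add (A i j), h0, C_0, add_zero, ← X_mul]
    simp [Matrix.mul_apply, G, J, o, this]
  have hYu : 1 + -Y ∈ elemMonoid (Fin k × ι) R[X] := by
    refine one_add_mem_elemMonoid_of_height (fun x => (x.1 : ℕ)) _ fun x y hxy => ?_
    by_contra h
    refine hxy ?_
    have h1 : ¬ ((x.1 : ℕ) = (y.1 : ℕ) + 1 ∧ x.2 = y.2) := by omega
    simp only [Matrix.neg_apply, Y, Matrix.of_apply, if_neg h1, neg_zero]
  -- One Horner step: consecutive tails, the later one multiplied by `t`, differ by one coefficient.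
  -- In the last block the later tail vanishes by the degree bound.
  have hGY (i : ι) (y : Fin k × ι) :
      G i y - (G * Y) i y = X * C ((A i y.2).coeff ((y.1 : ℕ) + 1)) := by
    have hstep : divX^[(y.1 : ℕ) + 1] (A i y.2) =
        X * divX^[(y.1 : ℕ) + 1 + 1] (A i y.2) + C ((A i y.2).coeff ((y.1 : ℕ) + 1)) := by
      conv_lhs => rw [← divX_mul_X_add (divX^[(y.1 : ℕ) + 1] (A i y.2))]
      rw [coeff_divX_iterate, zero_add, ← X_mul, ← Function.iterate_succ_apply' divX]
    have hsum : (G * Y) i y = X * (X * divX^[(y.1 : ℕ) + 1 + 1] (A i y.2)) := by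
      rw [Matrix.mul_apply]
      by_cases hy : (y.1 : ℕ) + 1 < k
      · rw [Finset.sum_eq_single (⟨(y.1 : ℕ) + 1, hy⟩, y.2)]
        · simp [G, Y, X_mul]
        · rintro ⟨c, l⟩ _ hne
          have : ¬ ((c : ℕ) = (y.1 : ℕ) + 1 ∧ l = y.2) := fun h =>
            hne (Prod.ext (Fin.ext h.1) h.2)
          simp only [Y, Matrix.of_apply, if_neg this, mul_zero]
        · simp
      · have hz : divX^[(y.1 : ℕ) + 1 + 1] (A i y.2) = 0 := by
          ext n
          rw [coeff_divX_iterate, coeff_zero]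
          exact coeff_eq_zero_of_natDegree_lt ((hk i y.2).trans_lt (by omega))
        rw [hz, mul_zero, mul_zero]
        refine Finset.sum_eq_zero fun c _ => ?_
        have h1 : ¬ ((c.1 : ℕ) = (y.1 : ℕ) + 1 ∧ c.2 = y.2) := by
          have := c.1.2
          omega
        simp only [Y, Matrix.of_apply, if_neg h1, mul_zero]
    rw [hsum]
    simp only [G, Matrix.of_apply]
    conv_lhs => rw [hstep]
    rw [mul_add, add_sub_cancel_left]
  have hfac : (1 - J * G) * (1 + -Y) =
      1 - timesT (Matrix.comp _ _ _ _ _ (companion k (coeffMat A))) := by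
    have h1 : (1 - J * G) * (1 + -Y) = 1 - (J * (G - G * Y) + Y) := by
      rw [Matrix.mul_sub, ← Matrix.mul_assoc]
      noncomm_ring
    rw [h1]
    congr 1
    ext1 ⟨a, i⟩ ⟨b, j⟩
    rw [Matrix.add_apply, Matrix.mul_apply]
    simp only [Matrix.sub_apply, hGY, timesT, Matrix.map_apply, Matrix.comp_apply, companion,
      Matrix.of_apply, J, Y]
    by_cases h0 : (a : ℕ) = 0
    · have ha : a = o := Fin.ext h0
      rw [if_pos h0, if_neg (by omega : ¬ ((a : ℕ) = (b : ℕ) + 1 ∧ i = j)), ha]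
      simp [coeffMat]
    · have ha (l : ι) : ((a, i) : Fin k × ι) ≠ (o, l) := fun h =>
        h0 (congrArg Fin.val (congrArg Prod.fst h))
      rw [if_neg h0, Finset.sum_eq_zero (fun l _ => by rw [if_neg (ha l), zero_mul]), zero_add]
      by_cases h1 : (a : ℕ) = (b : ℕ) + 1
      · rw [if_pos h1, Matrix.one_apply]
        by_cases h2 : i = j <;> simp [h1, h2]
      · simp [h1]
  rw [← stableClass_eq_of_mul_one_add hYu hfac, stableClass_mul_comm, hGJ]

theorem elEquiv_tMul_box {n k : ℕ} {A : Matrix (Fin n) (Fin n) R[X]} (hA : OverT A)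
    (hk : ∀ i j, (A i j).natDegree ≤ k) : ElEquiv (1 - tMul (box k A)) (1 - A) := by
  rw [← stableClass_fin, ← stableClass_timesT_companion (evalZero_eq_zero_of_overT hA) hk,
    ← stableClass_submatrix finProdFinEquiv.symm]
  congr 1
  ext1 x y
  simp only [tMul, timesT, Matrix.map_apply, Matrix.submatrix_apply]
  congr 2
  simp only [box, Matrix.reindex_apply, Matrix.submatrix_apply, Matrix.comp_apply, companion,
    Matrix.of_apply]
  by_cases h0 : ((finProdFinEquiv.symm x).1 : ℕ) = 0
  · rw [if_pos h0, if_pos h0]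
    rfl
  · rw [if_neg h0, if_neg h0]
    by_cases h1 : ((finProdFinEquiv.symm x).1 : ℕ) = ((finProdFinEquiv.symm y).1 : ℕ) + 1
    · simp only [h1, true_and, if_true, Matrix.one_apply]
    · simp only [h1, false_and, if_false, Matrix.zero_apply]

/-- For an elementary step, `tUV = (tU)V`, while `V(tU) = tVU` because `t` is central. -/
theorem elEquiv_tMul_of_sse {A B : SqMat R} (h : SSE A B) :
    ElEquiv (1 - tMul A.2) (1 - tMul B.2) := by
  have key {A B : SqMat R} (h : ESSE A B) : ElEquiv (1 - tMul A.2) (1 - tMul B.2) := by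
    obtain ⟨U, V, hA, hB⟩ := h
    have h1 : tMul A.2 = (U.map fun a => X * C a) * V.map C := by
      ext1 i j
      simp only [hA, tMul, Matrix.mul_apply, Matrix.map_apply, map_sum, map_mul, Finset.mul_sum,
        mul_assoc]
    have h2 : tMul B.2 = V.map C * (U.map fun a => X * C a) := by
      ext1 i j
      simp only [hB, tMul, Matrix.mul_apply, Matrix.map_apply, map_sum, map_mul, Finset.mul_sum]
      refine Finset.sum_congr rfl fun l _ => ?_
      rw [← mul_assoc, ← mul_assoc, X_mul]
    rw [h1, h2]
    exact elEquiv_one_sub_mul_comm _ _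
  induction h with
  | single h => exact key h
  | tail _ h ih => exact ih.trans (key h)

end Linearization

/-! ### The two mutually inverse maps -/

section Bijection

variable {R : Type u} [Ring R]

theorem overT_one_sub (M : OneSubMat R) : OverT (1 - M.1.2) := by
  obtain ⟨M, A, hA, hM⟩ := M
  have : 1 - M.2 = A := by rw [hM, sub_sub_cancel]
  exact this ▸ hA

/-- The map from `El(R[t])` classes to SSE classes. -/
noncomputable def elToSSE : ElClasses R → SSEClasses R :=
  Quotient.lift (fun M : OneSubMat R => polyClass (1 - M.1.2)) fun M N h =>
    polyClass_eq_of_elEquiv (overT_one_sub M) (overT_one_sub N) (by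
      rw [sub_sub_cancel, sub_sub_cancel]
      exact h)

theorem elToSSE_elClass {n : ℕ} (A : Matrix (Fin n) (Fin n) R[X]) (hA : OverT A) :
    elToSSE (elClass A hA) = polyClass A := by
  change polyClass (1 - (1 - A)) = _
  rw [sub_sub_cancel]

theorem elClass_eq_iff {n m : ℕ} {A : Matrix (Fin n) (Fin n) R[X]}
    {B : Matrix (Fin m) (Fin m) R[X]} (hA : OverT A) (hB : OverT B) :
    elClass A hA = elClass B hB ↔ ElEquiv (1 - A) (1 - B) :=
  Quotient.eq

theorem exists_eq_elClass (x : ElClasses R) :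
    ∃ (n : ℕ) (A : Matrix (Fin n) (Fin n) R[X]) (hA : OverT A), x = elClass A hA := by
  obtain ⟨⟨⟨n, M⟩, A, hA, hM⟩, rfl⟩ := Quotient.exists_rep x
  change Matrix (Fin n) (Fin n) R[X] at A
  change M = 1 - A at hM
  subst hM
  exact ⟨n, A, hA, rfl⟩

/-- The map from SSE classes to `El(R[t])` classes. -/
noncomputable def sseToEl : SSEClasses R → ElClasses R :=
  Quotient.lift (fun A : SqMat R => elClass (tMul A.2) (overT_tMul A.2)) fun _ _ h =>
    (elClass_eq_iff _ _).2 (elEquiv_tMul_of_sse h)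

/-- The bijection between `El(R[t])` classes and SSE classes. -/
noncomputable def elEquivSSE : ElClasses R ≃ SSEClasses R where
  toFun := elToSSE
  invFun := sseToEl
  left_inv x := by
    obtain ⟨n, A, hA, rfl⟩ := exists_eq_elClass x
    have h0 : st0 n A = A := by
      ext1 i j
      simp [st0]
    -- The class is represented by the unpadded `box`, to which linearization applies directly.
    rw [elToSSE_elClass, polyClass_eq_sseClass_box hA (natDegree_le_degBound A) le_rfl, h0]
    exact (elClass_eq_iff (overT_tMul _) hA).2 (elEquiv_tMul_box hA (natDegree_le_degBound A))
  right_inv x := by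
    obtain ⟨⟨n, A⟩, rfl⟩ := Quotient.exists_rep x
    change elToSSE (elClass (tMul A) (overT_tMul A)) = sseClass A
    rw [elToSSE_elClass, polyClass_tMul]

end Bijection

end SSEK

theorem theorem6p2 (R : Type*) [Ring R] :
    (∃ Φ : SSEK.ElClasses R ≃ SSEK.SSEClasses R,
      (∀ (n : ℕ) (A : Matrix (Fin n) (Fin n) (Polynomial R)) (hA : SSEK.OverT A) (k N : ℕ),
        (∀ i j, (A i j).natDegree ≤ k) → n ≤ N →
          Φ (SSEK.elClass A hA) = SSEK.sseClass (SSEK.box k (SSEK.st0 N A))) ∧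
      (∀ (n : ℕ) (A : Matrix (Fin n) (Fin n) R),
        Φ.symm (SSEK.sseClass A) = SSEK.elClass (SSEK.tMul A) (SSEK.overT_tMul A))) ∧
    (∀ (n m : ℕ) (A : Matrix (Fin n) (Fin n) R) (B : Matrix (Fin m) (Fin m) R),
      SSEK.SSE ⟨n, A⟩ ⟨m, B⟩ ↔ SSEK.ElEquiv (1 - SSEK.tMul A) (1 - SSEK.tMul B)) := by
  refine ⟨⟨SSEK.elEquivSSE, fun n A hA k N hk hN => ?_, fun n A => rfl⟩, fun n m A B => ?_⟩
  · exact (SSEK.elToSSE_elClass A hA).trans (SSEK.polyClass_eq_sseClass_box hA hk hN)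
  · refine ⟨fun h => SSEK.elEquiv_tMul_of_sse h, fun h => ?_⟩
    have := SSEK.polyClass_eq_of_elEquiv (SSEK.overT_tMul A) (SSEK.overT_tMul B) h
    rw [SSEK.polyClass_tMul, SSEK.polyClass_tMul] at this
    exact Quotient.exact this
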